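/- **Theorem 1.8 (finite-time breakdown, undamped cold-ion system).** Consider on $\mathbb R$ the Euler–Poisson system $$\partial_t\rho+\partial_x(\rho u)=0,\qquad \partial_t u+u\,\partial_x u=-\partial_x\phi,\qquad -\partial_{xx}\phi=\rho-e^{\phi},$$ around the constant state $(1,0)$, i.e. $(\rho,u)(t,x)\to(1,0)$ and $\phi(t,x)\to0$ as $|x|\to\infty$, with initial data $(\rho,u)(0,\cdot)=(\rho_0,u_0)$, $\rho_0\ge 0$. A classical solution on $[0,T)$ is a pair $(\rho,u)$, with potential $\phi(t,\cdot)\in C^2(\mathbb R)$, that satisfies all this pointwise and is of class $\mathcal C^1$ on $[0,T)\times\mathbb R$: each $f\in\{\rho,u\}$ is continuously differentiable there, and $|f|+|\partial_tf|+|\partial_xf|$ is bounded on $[0,T']\times\mathbb R$ for every $T'<T$. Let $\phi_0\in C^2(\mathbb R)$ be the initial potential, $-\phi_0''=\rho_0-e^{\phi_0}$ with $\phi_0(x)\to0$ as $|x|\to\infty$, let $U(r)=(r-1)e^r+1$, and assume that the initial energy $$H_0=\int_{\mathbb R}\Big(\tfrac12\rho_0u_0^2+\tfrac12|\phi_0'|^2+U(\phi_0)\Big)\,dx$$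 is finite. Put $V_+(z)=\int_0^z\sqrt{2U(r)}\,dr$ for $z\ge0$ and $V_-(z)=\int_z^0\sqrt{2U(r)}\,dr$ for $z\le0$; these are bijections of $[0,\infty)$, respectively $(-\infty,0]$, onto $[0,\infty)$. Let $c_\pm=\exp\big(V_\pm^{-1}(H_0)\big)$. Suppose that there is a point $x\in\mathbb R$ at which $$-\sqrt{2\rho_0(x)-c_-}<u_0'(x)<\sqrt{2\rho_0(x)-c_++\frac4{c_-}\Big(\frac{c_+}{c_-}-1\Big)\rho_0(x)^2}$$ fails (where $2\rho_0(x)<c_-$ both radicands are negative, and the condition counts as failing). Then the classical solution loses $\mathcal C^1$ regularity in finite time: there is a finite $T_*>0$, depending only on $(\rho_0,u_0)$, such that every classical solution on $[0,T)$ with initial data $(\rho_0,u_0)$ has $T\le T_*$. -/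

import Mathlib

open Set Filter Topology MeasureTheory

noncomputable section

namespace ColdIon

/-- `f ∈ C¹([0,T) × ℝ)`: `f` is continuously differentiable on `[0,T) × ℝ` (one-sided in time at
`t = 0`), and `|f| + |∂ₜ f| + |∂ₓ f|` is bounded on `[0,T'] × ℝ` for every `T' < T`. -/
def IsClassC1 (T : ℝ) (f : ℝ → ℝ → ℝ) : Prop :=
  ContDiffOn ℝ 1 (fun p : ℝ × ℝ => f p.1 p.2) (Ico 0 T ×ˢ univ) ∧
  ∀ T' < T, ∃ M : ℝ, ∀ t ∈ Icc 0 T', ∀ x : ℝ,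
    |f t x| + |derivWithin (fun s => f s x) (Ici 0) t| + |deriv (f t) x| ≤ M

/-- `φ` is the electric potential generated by the density `ρ` (at a fixed time):
a `C²` solution of `-φ'' = ρ - e^φ` on `ℝ` with `φ(x) → 0` as `|x| → ∞`. -/
structure IsPotential (ρ φ : ℝ → ℝ) : Prop where
  contDiff : ContDiff ℝ 2 φ
  poisson : ∀ x, -deriv (deriv φ) x = ρ x - Real.exp (φ x)
  decay : Tendsto φ (cocompact ℝ) (𝓝 0)

/-- `(ρ, u)`, with potential `φ`, is a classical solution on `[0,T) × ℝ` of the undamped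
Euler--Poisson system for cold ions around the constant state `(1,0)`, with initial data
`(ρ₀, u₀)`. -/
structure IsClassicalSolution (T : ℝ) (ρ₀ u₀ : ℝ → ℝ) (ρ u φ : ℝ → ℝ → ℝ) : Prop where
  pos : 0 < T
  density_C1 : IsClassC1 T ρ
  velocity_C1 : IsClassC1 T u
  continuity : ∀ t ∈ Ioo 0 T, ∀ x,
    deriv (fun s => ρ s x) t + deriv (fun y => ρ t y * u t y) x = 0
  momentum : ∀ t ∈ Ioo 0 T, ∀ x,
    deriv (fun s => u s x) t + u t x * deriv (u t) x = -deriv (φ t) x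
  potential : ∀ t ∈ Ico 0 T, IsPotential (ρ t) (φ t)
  density_infty : ∀ t ∈ Ico 0 T, Tendsto (ρ t) (cocompact ℝ) (𝓝 1)
  velocity_infty : ∀ t ∈ Ico 0 T, Tendsto (u t) (cocompact ℝ) (𝓝 0)
  density_init : ∀ x, ρ 0 x = ρ₀ x
  velocity_init : ∀ x, u 0 x = u₀ x

/-- `U(r) = (r - 1) e^r + 1`. -/
def U (r : ℝ) : ℝ := (r - 1) * Real.exp r + 1

/-- The energy density `½ ρ u² + ½ |∂ₓφ|² + U(φ)` at a fixed time. -/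
def energyDensity (ρ u φ : ℝ → ℝ) (x : ℝ) : ℝ :=
  1 / 2 * ρ x * u x ^ 2 + 1 / 2 * deriv φ x ^ 2 + U (φ x)

/-- The total energy at a fixed time. -/
def energy (ρ u φ : ℝ → ℝ) : ℝ := ∫ x, energyDensity ρ u φ x

/-- `V₊(z) = ∫₀ᶻ √(2U(r)) dr`, used for `z ≥ 0`. -/
def Vplus (z : ℝ) : ℝ := ∫ r in (0 : ℝ)..z, Real.sqrt (2 * U r)

/-- `V₋(z) = ∫_z⁰ √(2U(r)) dr`, used for `z ≤ 0`. -/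
def Vminus (z : ℝ) : ℝ := ∫ r in z..(0 : ℝ), Real.sqrt (2 * U r)

/-- `c₊ = exp (V₊⁻¹(H))`, with `V₊⁻¹` the inverse of the bijection `V₊ : [0,∞) → [0,∞)`. -/
def cplus (H : ℝ) : ℝ := Real.exp (Function.invFunOn Vplus (Ici 0) H)

/-- `c₋ = exp (V₋⁻¹(H))`, with `V₋⁻¹` the inverse of the bijection `V₋ : (-∞,0] → [0,∞)`. -/
def cminus (H : ℝ) : ℝ := Real.exp (Function.invFunOn Vminus (Iic 0) H)

/-- The pointwise threshold condition
`-√(2ρ₀ - c₋) < u₀' < √(2ρ₀ - c₊ + (4/c₋)(c₊/c₋ - 1) ρ₀²)` for given values `r = ρ₀(x)` and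
`v = u₀'(x)`. When `0 ≤ r < c₋/2` both radicands are negative (if `0 < c₋ ≤ c₊`), both roots are
`0` by convention, and the condition fails, as it should. -/
def Threshold (cm cp r v : ℝ) : Prop :=
  -Real.sqrt (2 * r - cm) < v ∧
    v < Real.sqrt (2 * r - cp + 4 / cm * (cp / cm - 1) * r ^ 2)

end ColdIon

end

/-! Along a characteristic X put y = `stretch u X`, the exponential of the time integral of uₓ. Mass
conservation makes ρ y constant (`density_mul_stretch`). Differentiating the momentum equation in x
and inserting the Poisson equation then gives y'' + e^φ y = ρ₀(X 0) with y(0) = 1 and y'(0) = u₀'(X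
0) (`deriv_mul_stretch`, `isPosSolution_stretch`). A classical solution keeps y positive, so it is
enough to show that y would have to vanish within a time fixed by the data.

The coefficient e^φ depends nonlocally on the solution, but the energy confines it to [c₋, c₊].
Since V₊' = √(2U), the x-derivative of V₊(φ) is at most ½φₓ² + U(φ) in absolute value, so |V₊(φ)| is
bounded by the energy (`abs_Vplus_le`). The energy does not exceed its initial value
(`potential_energy_le`). No regularity of φ in time is assumed: the maximum principle for the
Poisson equation supplies Lipschitz bounds, and convexity of the field energy in (φₓ, e^φ) replaces
its time derivative by a one-sided estimate (`energy_le_add`). The boundary terms on [-R,R] are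
small because u and φ decay uniformly on compact time intervals.

What remains concerns the scalar equation with c₋ ≤ e^φ ≤ c₊ and r = ρ₀(X 0) (`lifespan_le`). The
function y - r/c₋ lies below the oscillator of frequency √c₋, so a decreasing y with enough energy
reaches zero within half a period. If y' starts large and positive, the quantity y'² + c₊ y² - 2 r y
does not decrease while y' ≥ 0. Hence y stops growing after a bounded time, and only at a height of
at least 2r/c₋, from which the first case applies. -/

noncomputable section

namespace ColdIon

/-! ### Functions of class `C¹` on `[0,T) × ℝ` -/

namespace IsClassC1

variable {T : ℝ} {f : ℝ → ℝ → ℝ}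

theorem continuousOn (hf : IsClassC1 T f) :
    ContinuousOn (fun p : ℝ × ℝ => f p.1 p.2) (Ico 0 T ×ˢ univ) :=
  hf.1.continuousOn

theorem differentiableAt (hf : IsClassC1 T f) {t : ℝ} (ht : t ∈ Ioo 0 T) (x : ℝ) :
    DifferentiableAt ℝ (fun p : ℝ × ℝ => f p.1 p.2) (t, x) := by
  have hd := hf.1.differentiableOn one_ne_zero (t, x) ⟨⟨ht.1.le, ht.2⟩, mem_univ _⟩
  exact hd.differentiableAt (prod_mem_nhds (Ico_mem_nhds ht.1 ht.2) univ_mem)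

theorem hasDerivAt_space' (hf : IsClassC1 T f) {t : ℝ} (ht : t ∈ Ico 0 T) (x : ℝ) :
    HasDerivAt (f t)
      (fderivWithin ℝ (fun p : ℝ × ℝ => f p.1 p.2) (Ico 0 T ×ˢ univ) (t, x) (0, 1)) x := by
  have hd := (hf.1.differentiableOn one_ne_zero (t, x) ⟨ht, mem_univ _⟩).hasFDerivWithinAt
  have hc : HasDerivWithinAt (fun y : ℝ => (t, y)) ((0 : ℝ), (1 : ℝ)) univ x :=
    ((hasDerivAt_const x t).prodMk (hasDerivAt_id x)).hasDerivWithinAt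
  have := hd.comp_hasDerivWithinAt x hc (fun y _ => ⟨ht, mem_univ _⟩)
  exact hasDerivWithinAt_univ.1 this

theorem hasDerivAt_space (hf : IsClassC1 T f) {t : ℝ} (ht : t ∈ Ico 0 T) (x : ℝ) :
    HasDerivAt (f t) (deriv (f t) x) x :=
  (hf.hasDerivAt_space' ht x).differentiableAt.hasDerivAt

theorem hasDerivAt_time (hf : IsClassC1 T f) {t : ℝ} (ht : t ∈ Ioo 0 T) (x : ℝ) :
    HasDerivAt (fun s => f s x) (deriv (fun s => f s x) t) t := by
  have hc : HasDerivAt (fun s : ℝ => (s, x)) ((1 : ℝ), (0 : ℝ)) t :=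
    (hasDerivAt_id t).prodMk (hasDerivAt_const t x)
  exact ((hf.differentiableAt ht x).hasFDerivAt.comp_hasDerivAt t
    hc).differentiableAt.hasDerivAt

/-- The chain rule along a curve `s ↦ (s, X s)`. -/
theorem hasDerivAt_along (hf : IsClassC1 T f) {t : ℝ} (ht : t ∈ Ioo 0 T) {X : ℝ → ℝ} {v : ℝ}
    (hX : HasDerivAt X v t) :
    HasDerivAt (fun s => f s (X s))
      (deriv (fun s => f s (X t)) t + v * deriv (f t) (X t)) t := by
  have hd := (hf.differentiableAt ht (X t)).hasFDerivAt
  set L := fderiv ℝ (fun p : ℝ × ℝ => f p.1 p.2) (t, X t)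
  have h1 : deriv (fun s => f s (X t)) t = L (1, 0) :=
    (hd.comp_hasDerivAt (f := fun s => (s, X t)) t
      ((hasDerivAt_id t).prodMk (hasDerivAt_const t (X t)))).deriv
  have h2 : deriv (f t) (X t) = L (0, 1) :=
    (hd.comp_hasDerivAt (f := fun y => (t, y)) (X t)
      ((hasDerivAt_const (X t) t).prodMk (hasDerivAt_id (X t)))).deriv
  have h3 := hd.comp_hasDerivAt t ((hasDerivAt_id t).prodMk hX)
  have h4 : L (1, v) = L (1, 0) + v * L (0, 1) := by
    have : ((1 : ℝ), v) = (1, 0) + v • ((0 : ℝ), (1 : ℝ)) := by simp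
    rw [this, map_add, map_smul, smul_eq_mul]
  rw [h1, h2, ← h4]
  exact h3

theorem continuousOn_deriv_space (hf : IsClassC1 T f) :
    ContinuousOn (fun p : ℝ × ℝ => deriv (f p.1) p.2) (Ico 0 T ×ˢ univ) := by
  have hu : UniqueDiffOn ℝ (Ico 0 T ×ˢ (univ : Set ℝ)) :=
    (uniqueDiffOn_Ico 0 T).prod uniqueDiffOn_univ
  have h := hf.1.continuousOn_fderivWithin hu le_rfl
  exact (h.clm_apply (continuousOn_const (c := ((0 : ℝ), (1 : ℝ))))).congr fun p hp =>
    (hf.hasDerivAt_space' hp.1 p.2).deriv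

theorem exists_bound (hf : IsClassC1 T f) {T' : ℝ} (hT' : T' < T) :
    ∃ M : ℝ, 0 ≤ M ∧ ∀ t ∈ Icc 0 T', ∀ x, |f t x| ≤ M ∧ |deriv (f t) x| ≤ M ∧
      (0 < t → |deriv (fun s => f s x) t| ≤ M) := by
  obtain ⟨M, hM⟩ := hf.2 T' hT'
  refine ⟨|M|, abs_nonneg _, fun t ht x => ?_⟩
  have h := (hM t ht x).trans (le_abs_self M)
  have h1 := abs_nonneg (f t x)
  have h2 := abs_nonneg (derivWithin (fun s => f s x) (Ici 0) t)
  have h3 := abs_nonneg (deriv (f t) x)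
  refine ⟨by linarith, by linarith, fun h0 => ?_⟩
  rw [derivWithin_of_mem_nhds (Ici_mem_nhds h0)] at h h2
  linarith

theorem lipschitz_space (hf : IsClassC1 T f) {t : ℝ} (ht : t ∈ Ico 0 T) {M : ℝ}
    (hM : ∀ x, |deriv (f t) x| ≤ M) (x y : ℝ) : |f t x - f t y| ≤ M * |x - y| := by
  have := convex_univ.norm_image_sub_le_of_norm_deriv_le (f := f t) (C := M) (x := y) (y := x)
    (fun z _ => (hf.hasDerivAt_space ht z).differentiableAt) (fun z _ => hM z)
    (mem_univ _) (mem_univ _)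
  simpa using this

theorem continuousOn_time (hf : IsClassC1 T f) (x : ℝ) :
    ContinuousOn (fun s => f s x) (Ico 0 T) :=
  hf.continuousOn.comp (f := fun s : ℝ => (s, x)) (by fun_prop) fun s hs => ⟨hs, mem_univ _⟩

theorem continuous_space (hf : IsClassC1 T f) {t : ℝ} (ht : t ∈ Ico 0 T) : Continuous (f t) :=
  continuous_iff_continuousAt.2 fun x => (hf.hasDerivAt_space ht x).continuousAt

theorem continuous_deriv_space (hf : IsClassC1 T f) {t : ℝ} (ht : t ∈ Ico 0 T) :
    Continuous (deriv (f t)) := by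
  rw [← continuousOn_univ]
  exact hf.continuousOn_deriv_space.comp (f := fun y : ℝ => (t, y)) (by fun_prop)
    fun s hs => ⟨ht, mem_univ _⟩

theorem continuousOn_along (hf : IsClassC1 T f) {s : Set ℝ} (hs : s ⊆ Ico 0 T) {X : ℝ → ℝ}
    (hX : ContinuousOn X s) : ContinuousOn (fun t => f t (X t)) s :=
  hf.continuousOn.comp (f := fun t : ℝ => (t, X t)) (continuousOn_id.prodMk hX)
    fun _ ht => ⟨hs ht, mem_univ _⟩

theorem continuousOn_deriv_along (hf : IsClassC1 T f) {s : Set ℝ} (hs : s ⊆ Ico 0 T) {X : ℝ → ℝ}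
    (hX : ContinuousOn X s) : ContinuousOn (fun t => deriv (f t) (X t)) s :=
  hf.continuousOn_deriv_space.comp (f := fun t : ℝ => (t, X t)) (continuousOn_id.prodMk hX)
    fun _ ht => ⟨hs ht, mem_univ _⟩

/-- The mean value theorem needs the time derivative only at interior points, so no derivative at t
= 0 enters. -/
theorem lipschitz_time (hf : IsClassC1 T f) {T' M : ℝ} (hT' : T' < T)
    (hM : ∀ t ∈ Icc 0 T', ∀ x, 0 < t → |deriv (fun s => f s x) t| ≤ M)
    {s t : ℝ} (hs : s ∈ Icc 0 T') (ht : t ∈ Icc 0 T') (x : ℝ) :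
    |f t x - f s x| ≤ M * |t - s| := by
  wlog hst : s ≤ t generalizing s t
  · rw [abs_sub_comm, abs_sub_comm t s]
    exact this ht hs (le_of_not_ge hst)
  have hc : ContinuousOn (fun s => f s x) (Icc s t) :=
    (hf.continuousOn_time x).mono fun r hr => ⟨hs.1.trans hr.1, (hr.2.trans ht.2).trans_lt hT'⟩
  rcases hst.eq_or_lt with rfl | hlt
  · simp
  obtain ⟨c, hc, hc'⟩ := exists_deriv_eq_slope (fun s => f s x) hlt hc fun r hr =>
    (hf.hasDerivAt_time ⟨hs.1.trans_lt hr.1, (hr.2.trans_le ht.2).trans hT'⟩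
      x).differentiableAt.differentiableWithinAt
  have hb := hM c ⟨hs.1.trans hc.1.le, hc.2.le.trans ht.2⟩ x (hs.1.trans_lt hc.1)
  rw [hc', abs_div, div_le_iff₀ (by simpa using sub_ne_zero.2 hlt.ne')] at hb
  exact hb

end IsClassC1

/-! ### The Poisson equation -/

/-- At a global maximum the second derivative is nonpositive. -/
theorem second_deriv_nonpos_of_max {f f' : ℝ → ℝ} {x c : ℝ} (hf : ∀ y, HasDerivAt f (f' y) y)
    (hf' : HasDerivAt f' c x) (hmax : ∀ y, f y ≤ f x) : c ≤ 0 := by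
  by_contra! hc
  have h0 : f' x = 0 := by
    have : IsLocalMax f x := Eventually.of_forall hmax
    exact this.hasDerivAt_eq_zero (hf x)
  -- A positive second derivative at a critical point would make f strictly increasing just to the
  -- right of its maximum.
  have h1 : ∀ᶠ y in 𝓝[>] x, 0 < f' y := by
    have h2 := (hasDerivAt_iff_tendsto_slope.1 hf').mono_left
      (nhdsWithin_mono x fun y (hy : x < y) => hy.ne')
    filter_upwards [h2.eventually (lt_mem_nhds hc), self_mem_nhdsWithin] with y hy hxy
    rw [slope_def_field, h0, sub_zero] at hy
    exact (div_pos_iff_of_pos_right (sub_pos.2 hxy)).1 hy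
  obtain ⟨b, hb, hbI⟩ := (mem_nhdsGT_iff_exists_Ioo_subset).1 h1
  obtain ⟨y, hy⟩ := exists_between (mem_Ioi.1 hb)
  have : StrictMonoOn f (Icc x y) := strictMonoOn_of_hasDerivWithinAt_pos (convex_Icc x y) (f' := f')
    (fun z _ => (hf z).continuousAt.continuousWithinAt) (fun z _ => (hf z).hasDerivWithinAt)
    fun z hz => by
      rw [interior_Icc] at hz
      exact hbI ⟨hz.1, hz.2.trans hy.2⟩
  exact absurd (this (left_mem_Icc.2 hy.1.le) (right_mem_Icc.2 hy.1.le) hy.1) (not_lt.2 (hmax y))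

/-- A bound on a function and its second derivative gives one on the first derivative. -/
theorem abs_deriv_le_of_second_deriv {f f' f'' : ℝ → ℝ} {A B : ℝ}
    (hf : ∀ y, HasDerivAt f (f' y) y) (hf' : ∀ y, HasDerivAt f' (f'' y) y)
    (hA : ∀ y, |f y| ≤ A) (hB : ∀ y, |f'' y| ≤ B) (x : ℝ) : |f' x| ≤ 2 * A + B := by
  -- On a unit interval the slope of f, of size at most 2A, is attained by f' at some c; the bound
  -- on f'' transfers it to x at the cost of B.
  obtain ⟨c, hc, hc'⟩ := exists_hasDerivAt_eq_slope f f' (lt_add_one x)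
    (fun z _ => (hf z).continuousAt.continuousWithinAt) (fun z _ => hf z)
  rw [add_sub_cancel_left, div_one] at hc'
  have h1 := convex_univ.norm_image_sub_le_of_norm_hasDerivWithin_le (f := f') (x := c) (y := x)
    (fun z _ => (hf' z).hasDerivWithinAt) (fun z _ => hB z) (mem_univ _) (mem_univ _)
  rw [Real.norm_eq_abs, Real.norm_eq_abs] at h1
  have hB0 : 0 ≤ B := (abs_nonneg _).trans (hB x)
  have h2 : |x - c| ≤ 1 := abs_le.2 ⟨by linarith [hc.2], by linarith [hc.1]⟩
  have h3 : |f' x - f' c| ≤ B := h1.trans (mul_le_of_le_one_right hB0 h2)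
  have h4 : |f' c| ≤ 2 * A := by
    rw [hc']
    exact (abs_sub _ _).trans (by linarith [hA (x + 1), hA x])
  calc |f' x| = |(f' x - f' c) + f' c| := by ring_nf
    _ ≤ |f' x - f' c| + |f' c| := abs_add_le _ _
    _ ≤ 2 * A + B := by linarith

theorem abs_exp_sub_exp_le {a b m : ℝ} (ha : a ≤ m) (hb : b ≤ m) :
    |Real.exp a - Real.exp b| ≤ Real.exp m * |a - b| := by
  wlog h : b ≤ a generalizing a b
  · rw [abs_sub_comm, abs_sub_comm a b]
    exact this hb ha (le_of_not_ge h)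
  rw [abs_of_nonneg (sub_nonneg.2 (Real.exp_le_exp.2 h)), abs_of_nonneg (sub_nonneg.2 h)]
  have h1 : Real.exp b = Real.exp a * Real.exp (b - a) := by rw [← Real.exp_add]; ring_nf
  have h2 := Real.add_one_le_exp (b - a)
  have h3 : Real.exp a ≤ Real.exp m := Real.exp_le_exp.2 ha
  have h4 := Real.exp_pos a
  calc Real.exp a - Real.exp b = Real.exp a * (1 - Real.exp (b - a)) := by rw [h1]; ring
    _ ≤ Real.exp a * (a - b) := mul_le_mul_of_nonneg_left (by linarith) h4.le
    _ ≤ Real.exp m * (a - b) := mul_le_mul_of_nonneg_right h3 (by linarith)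

namespace IsPotential

variable {ρ φ ρ₁ ρ₂ φ₁ φ₂ : ℝ → ℝ}

theorem hasDerivAt (h : IsPotential ρ φ) (x : ℝ) : HasDerivAt φ (deriv φ x) x :=
  (h.contDiff.differentiable two_ne_zero x).hasDerivAt

theorem hasDerivAt_deriv (h : IsPotential ρ φ) (x : ℝ) :
    HasDerivAt (deriv φ) (Real.exp (φ x) - ρ x) x := by
  have hd : ContDiff ℝ 1 (deriv φ) :=
    (contDiff_succ_iff_deriv.1 (show ContDiff ℝ (1 + 1) φ by
      rw [one_add_one_eq_two]; exact h.contDiff)).2.2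
  have h1 := (hd.differentiable one_ne_zero x).hasDerivAt
  have h2 := h.poisson x
  rwa [show deriv (deriv φ) x = Real.exp (φ x) - ρ x by linarith] at h1

theorem continuous (h : IsPotential ρ φ) : Continuous φ := h.contDiff.continuous

theorem continuous_deriv (h : IsPotential ρ φ) : Continuous (deriv φ) :=
  continuous_iff_continuousAt.2 fun x => (h.hasDerivAt_deriv x).continuousAt

theorem zero : IsPotential (fun _ => 1) fun _ => 0 where
  contDiff := contDiff_const
  poisson x := by simp
  decay := tendsto_const_nhds

/-- The maximum principle for the difference of two potentials. -/
theorem exists_max (h₁ : IsPotential ρ₁ φ₁) (h₂ : IsPotential ρ₂ φ₂) {ε : ℝ}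
    (hε : ∀ x, ρ₁ x - ρ₂ x ≤ ε) {x : ℝ} (hx : 0 < φ₁ x - φ₂ x) :
    ∃ x₀, φ₁ x - φ₂ x ≤ φ₁ x₀ - φ₂ x₀ ∧ Real.exp (φ₁ x₀) - Real.exp (φ₂ x₀) ≤ ε := by
  have hlim : Tendsto (fun y => φ₁ y - φ₂ y) (cocompact ℝ) (𝓝 0) := by
    simpa using h₁.decay.sub h₂.decay
  obtain ⟨x₀, hx₀⟩ := (h₁.continuous.sub h₂.continuous).exists_forall_ge' x
    ((hlim.eventually (gt_mem_nhds hx)).mono fun y hy => hy.le)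
  have h := second_deriv_nonpos_of_max (fun y => (h₁.hasDerivAt y).sub (h₂.hasDerivAt y))
    ((h₁.hasDerivAt_deriv x₀).sub (h₂.hasDerivAt_deriv x₀)) hx₀
  exact ⟨x₀, hx₀ x, by linarith [hε x₀]⟩

theorem le_of_le (h₁ : IsPotential ρ₁ φ₁) (h₂ : IsPotential ρ₂ φ₂) (h : ∀ x, ρ₁ x ≤ ρ₂ x) (x : ℝ) :
    φ₁ x ≤ φ₂ x := by
  by_contra! hx
  obtain ⟨x₀, h3, h4⟩ := h₁.exists_max h₂ (ε := 0) (fun y => sub_nonpos.2 (h y)) (sub_pos.2 hx)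
  have := Real.exp_le_exp.1 (sub_nonpos.1 h4)
  linarith

theorem unique (h₁ : IsPotential ρ φ₁) (h₂ : IsPotential ρ φ₂) : φ₁ = φ₂ :=
  funext fun x => le_antisymm (h₁.le_of_le h₂ (fun _ => le_rfl) x)
    (h₂.le_of_le h₁ (fun _ => le_rfl) x)

/-- The nonlinearity is coercive where φ₂ is bounded below: at the maximum point e^φ₁ - e^φ₂ ≥ e^φ₂
(φ₁ - φ₂). This is the source of Lipschitz dependence of the potential on the density. -/
theorem sub_le (h₁ : IsPotential ρ₁ φ₁) (h₂ : IsPotential ρ₂ φ₂) {ε m : ℝ} (hε0 : 0 ≤ ε)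
    (hε : ∀ x, ρ₁ x - ρ₂ x ≤ ε) (hm : ∀ x, -m ≤ φ₂ x) (x : ℝ) :
    φ₁ x - φ₂ x ≤ Real.exp m * ε := by
  rcases le_or_gt (φ₁ x - φ₂ x) 0 with hx | hx
  · exact hx.trans (by positivity)
  obtain ⟨x₀, h3, h4⟩ := h₁.exists_max h₂ hε hx
  refine h3.trans ?_
  have h5 := Real.add_one_le_exp (φ₁ x₀ - φ₂ x₀)
  have h6 : Real.exp (φ₁ x₀) = Real.exp (φ₂ x₀) * Real.exp (φ₁ x₀ - φ₂ x₀) := by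
    rw [← Real.exp_add]; ring_nf
  have h7 : Real.exp (φ₂ x₀) * (φ₁ x₀ - φ₂ x₀) ≤ ε := by
    have := Real.exp_pos (φ₂ x₀)
    nlinarith
  have h8 : Real.exp (-m) ≤ Real.exp (φ₂ x₀) := Real.exp_le_exp.2 (hm x₀)
  have h9 : Real.exp (-m) * (φ₁ x₀ - φ₂ x₀) ≤ ε :=
    (mul_le_mul_of_nonneg_right h8 (by linarith)).trans h7
  rw [Real.exp_neg, inv_mul_le_iff₀ (Real.exp_pos m)] at h9
  exact h9

theorem le_of_density_le (h : IsPotential ρ φ) {M : ℝ} (hM0 : 0 ≤ M) (hM : ∀ x, ρ x - 1 ≤ M)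
    (x : ℝ) : φ x ≤ M := by
  have := h.sub_le zero (m := 0) hM0 hM (by simp) x
  simpa using this

theorem exists_lower_bound (h : IsPotential ρ φ) : ∃ m, ∀ x, -m ≤ φ x := by
  by_cases hx : ∃ x, φ x < 0
  · obtain ⟨x, hx⟩ := hx
    obtain ⟨x₀, hx₀⟩ := h.continuous.exists_forall_le' x
      ((h.decay.eventually (lt_mem_nhds hx)).mono fun y hy => hy.le)
    exact ⟨-φ x₀, by simpa using hx₀⟩
  · exact ⟨0, by simpa using hx⟩

/-- Lower bounds for the potential are stable under small perturbations of the density. -/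
theorem lower_bound_of_close (h₁ : IsPotential ρ₁ φ₁) (h₂ : IsPotential ρ₂ φ₂) {m : ℝ}
    (hm : ∀ x, -m ≤ φ₁ x) (hε : ∀ x, ρ₁ x - ρ₂ x ≤ Real.exp (-m) / 2) (x : ℝ) :
    -(m + 1) ≤ φ₂ x := by
  by_contra! hx
  obtain ⟨x₀, h3, h4⟩ := h₁.exists_max h₂ hε (x := x) (by linarith [hm x])
  have h5 : Real.exp (-m) ≤ Real.exp (φ₁ x₀) := Real.exp_le_exp.2 (hm x₀)
  have h6 : φ₂ x₀ ≤ φ₁ x₀ - 1 := by linarith [hm x]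
  have h7 : Real.exp (φ₂ x₀) ≤ Real.exp (φ₁ x₀ - 1) := Real.exp_le_exp.2 h6
  rw [Real.exp_sub, le_div_iff₀ (Real.exp_pos 1)] at h7
  -- Lowering the potential by 1 more than halves its exponential, which is incompatible with a
  -- density difference of at most e^(-m)/2.
  have h8 : 2 < Real.exp 1 := by linarith [Real.exp_one_gt_d9]
  have h9 := Real.exp_pos (φ₂ x₀)
  nlinarith

end IsPotential

/-- Uniform bounds and Lipschitz bounds in time for the potential of a Lipschitz family of
densities. -/
theorem exists_potential_bounds {T' M : ℝ} {ρ φ : ℝ → ℝ → ℝ} (hM0 : 0 ≤ M)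
    (hρ : ∀ t ∈ Icc 0 T', ∀ x, |ρ t x| ≤ M)
    (hlip : ∀ s ∈ Icc 0 T', ∀ t ∈ Icc 0 T', ∀ x, |ρ t x - ρ s x| ≤ M * |t - s|)
    (hφ : ∀ t ∈ Icc 0 T', IsPotential (ρ t) (φ t)) :
    ∃ C, 0 ≤ C ∧ (∀ t ∈ Icc 0 T', ∀ x, |φ t x| ≤ C ∧ |deriv (φ t) x| ≤ C) ∧
      (∀ s ∈ Icc 0 T', ∀ t ∈ Icc 0 T', ∀ x, |φ t x - φ s x| ≤ C * |t - s|) ∧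
      ∀ s ∈ Icc 0 T', ∀ t ∈ Icc 0 T', ∀ x, |deriv (φ t) x - deriv (φ s) x| ≤ C * |t - s| := by
  -- The density may vanish, so the maximum principle yields no explicit lower bound. Each single
  -- potential is bounded below by continuity and decay, and `lower_bound_of_close` with compactness
  -- of the time interval makes the bound uniform.
  obtain ⟨m₀, hm₀⟩ : ∃ m, ∀ t ∈ Icc 0 T', ∀ x, -m ≤ φ t x := by
    refine isCompact_Icc.induction_on (p := fun S => ∃ m, ∀ t ∈ S, ∀ x, -m ≤ φ t x) ⟨0, by simp⟩
      ?_ ?_ ?_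
    · rintro S S' hS ⟨m, hm⟩
      exact ⟨m, fun t ht => hm t (hS ht)⟩
    · rintro S S' ⟨m, hm⟩ ⟨m', hm'⟩
      refine ⟨max m m', fun t ht x => ?_⟩
      rcases ht with ht | ht
      · exact (neg_le_neg (le_max_left _ _)).trans (hm t ht x)
      · exact (neg_le_neg (le_max_right _ _)).trans (hm' t ht x)
    · intro s hs
      obtain ⟨m, hm⟩ := (hφ s hs).exists_lower_bound
      have hlim : Tendsto (fun t => M * |s - t|) (𝓝[Icc 0 T'] s) (𝓝 0) := by
        have : Continuous fun t => M * |s - t| := by fun_prop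
        have := this.tendsto s
        simp only [sub_self, abs_zero, mul_zero] at this
        exact this.mono_left nhdsWithin_le_nhds
      have he : (0 : ℝ) < Real.exp (-m) / 2 := by positivity
      refine ⟨{t | t ∈ Icc 0 T' ∧ M * |s - t| < Real.exp (-m) / 2}, ?_, m + 1, ?_⟩
      · filter_upwards [hlim.eventually (gt_mem_nhds he), self_mem_nhdsWithin] with t h1 h2
        exact ⟨h2, h1⟩
      · rintro t ⟨ht, htm⟩ x
        exact (hφ s hs).lower_bound_of_close (hφ t ht) hm
          (fun y => ((le_abs_self _).trans (hlip t ht s hs y)).trans htm.le) x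
  set m := max m₀ M
  have hm0 : 0 ≤ m := hM0.trans (le_max_right _ _)
  have hlow : ∀ t ∈ Icc 0 T', ∀ x, -m ≤ φ t x := fun t ht x =>
    (neg_le_neg (le_max_left _ _)).trans (hm₀ t ht x)
  have hupp : ∀ t ∈ Icc 0 T', ∀ x, φ t x ≤ m := fun t ht x =>
    ((hφ t ht).le_of_density_le hM0 (fun y => by linarith [(abs_le.1 (hρ t ht y)).2]) x).trans
      (le_max_right _ _)
  have habs : ∀ t ∈ Icc 0 T', ∀ x, |φ t x| ≤ m := fun t ht x =>
    abs_le.2 ⟨hlow t ht x, hupp t ht x⟩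
  set E := Real.exp m
  have hE : 0 < E := Real.exp_pos m
  have hE1 : ∀ t ∈ Icc 0 T', ∀ s ∈ Icc 0 T', ∀ x, |φ t x - φ s x| ≤ E * (M * |t - s|) := by
    intro t ht s hs x
    refine abs_sub_le_iff.2 ⟨?_, ?_⟩
    · exact (hφ t ht).sub_le (hφ s hs) (by positivity)
        (fun y => (le_abs_self _).trans (hlip s hs t ht y)) (hlow s hs) x
    · exact (hφ s hs).sub_le (hφ t ht) (by positivity)
        (fun y => (le_abs_self _).trans (by rw [abs_sub_comm]; exact hlip s hs t ht y))
        (hlow t ht) x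
  set A := E * M
  set B := E * A + M
  have hA : 0 ≤ A := by positivity
  have hB : 0 ≤ B := by positivity
  refine ⟨(2 * m + (E + M)) + (2 * A + B), by positivity, fun t ht x => ⟨?_, ?_⟩, ?_, ?_⟩
  · exact (habs t ht x).trans (by linarith)
  · refine (abs_deriv_le_of_second_deriv (hφ t ht).hasDerivAt (hφ t ht).hasDerivAt_deriv
      (habs t ht) (B := E + M) (fun y => ?_) x).trans (by linarith)
    refine (abs_sub _ _).trans (add_le_add ?_ (hρ t ht y))
    rw [abs_of_pos (Real.exp_pos _)]
    exact Real.exp_le_exp.2 (hupp t ht y)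
  · intro s hs t ht x
    refine (hE1 t ht s hs x).trans ?_
    rw [← mul_assoc]
    gcongr
    linarith
  · intro s hs t ht x
    refine (abs_deriv_le_of_second_deriv
      (fun y => ((hφ t ht).hasDerivAt y).sub ((hφ s hs).hasDerivAt y))
      (fun y => ((hφ t ht).hasDerivAt_deriv y).sub ((hφ s hs).hasDerivAt_deriv y))
      (hE1 t ht s hs) (B := B * |t - s|) (fun y => ?_) x).trans ?_
    · have h1 := (abs_exp_sub_exp_le (hupp t ht y) (hupp s hs y)).trans
        (mul_le_mul_of_nonneg_left (hE1 t ht s hs y) hE.le)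
      have h2 := hlip s hs t ht y
      calc |Real.exp (φ t y) - ρ t y - (Real.exp (φ s y) - ρ s y)|
          = |(Real.exp (φ t y) - Real.exp (φ s y)) - (ρ t y - ρ s y)| := by ring_nf
        _ ≤ |Real.exp (φ t y) - Real.exp (φ s y)| + |ρ t y - ρ s y| := abs_sub _ _
        _ ≤ E * (E * (M * |t - s|)) + M * |t - s| := add_le_add h1 h2
        _ = B * |t - s| := by simp only [B, A]; ring
    · have : 2 * (E * (M * |t - s|)) + B * |t - s| = (2 * A + B) * |t - s| := by
        simp only [A]; ring
      rw [this]
      exact mul_le_mul_of_nonneg_right (by linarith) (abs_nonneg _)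

/-- A family that is uniformly Lipschitz in time decays at infinity uniformly in time. -/
theorem exists_uniform_decay {T' C : ℝ} {f : ℝ → ℝ → ℝ}
    (hlip : ∀ s ∈ Icc 0 T', ∀ t ∈ Icc 0 T', ∀ x, |f t x - f s x| ≤ C * |t - s|)
    (hf : ∀ t ∈ Icc 0 T', Tendsto (f t) (cocompact ℝ) (𝓝 0)) {ε : ℝ} (hε : 0 < ε) :
    ∀ᶠ x in cocompact ℝ, ∀ t ∈ Icc 0 T', |f t x| ≤ ε := by
  refine isCompact_Icc.induction_on (p := fun S => ∀ᶠ x in cocompact ℝ, ∀ t ∈ S, |f t x| ≤ ε)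
    (by simp) ?_ ?_ ?_
  · intro S S' hS h
    exact h.mono fun x hx t ht => hx t (hS ht)
  · intro S S' h h'
    filter_upwards [h, h'] with x hx hx' t ht
    exact ht.elim (hx t) (hx' t)
  · intro s hs
    have hlim : Tendsto (fun t => C * |t - s|) (𝓝[Icc 0 T'] s) (𝓝 0) := by
      have : Continuous fun t => C * |t - s| := by fun_prop
      have := this.tendsto s
      simp only [sub_self, abs_zero, mul_zero] at this
      exact this.mono_left nhdsWithin_le_nhds
    refine ⟨{t | t ∈ Icc 0 T' ∧ C * |t - s| < ε / 2}, ?_, ?_⟩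
    · filter_upwards [hlim.eventually (gt_mem_nhds (half_pos hε)), self_mem_nhdsWithin] with t h1 h2
      exact ⟨h2, h1⟩
    · have h0 := ((hf s hs).abs).eventually (gt_mem_nhds (show |(0 : ℝ)| < ε / 2 by simpa using hε))
      filter_upwards [h0] with x hx t ht
      calc |f t x| = |(f t x - f s x) + f s x| := by ring_nf
        _ ≤ |f t x - f s x| + |f s x| := abs_add_le _ _
        _ ≤ ε := by linarith [hlip s hs t ht.1 x, ht.2]

/-- A family that is uniformly Lipschitz in time and continuous in space is jointly continuous. -/
theorem continuousOn_of_lipschitz_time {T' C : ℝ} {f : ℝ → ℝ → ℝ}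
    (hlip : ∀ s ∈ Icc 0 T', ∀ t ∈ Icc 0 T', ∀ x, |f t x - f s x| ≤ C * |t - s|)
    (hf : ∀ t ∈ Icc 0 T', Continuous (f t)) :
    ContinuousOn (fun p : ℝ × ℝ => f p.1 p.2) (Icc 0 T' ×ˢ univ) := by
  rintro ⟨s, x⟩ ⟨hs, -⟩
  have h1 : Tendsto (fun p : ℝ × ℝ => C * |p.1 - s| + |f s p.2 - f s x|)
      (𝓝[Icc 0 T' ×ˢ univ] (s, x)) (𝓝 0) := by
    have hc : Continuous fun p : ℝ × ℝ => C * |p.1 - s| + |f s p.2 - f s x| := by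
      have := hf s hs
      fun_prop
    have := hc.tendsto (s, x)
    simp only [sub_self, abs_zero, mul_zero, add_zero] at this
    exact this.mono_left nhdsWithin_le_nhds
  refine tendsto_iff_dist_tendsto_zero.2
    (squeeze_zero' (Eventually.of_forall fun _ => dist_nonneg) ?_ h1)
  filter_upwards [self_mem_nhdsWithin] with p hp
  rw [Real.dist_eq]
  calc |f p.1 p.2 - f s x| = |(f p.1 p.2 - f s p.2) + (f s p.2 - f s x)| := by ring_nf
    _ ≤ |f p.1 p.2 - f s p.2| + |f s p.2 - f s x| := abs_add_le _ _
    _ ≤ C * |p.1 - s| + |f s p.2 - f s x| := by gcongr; exact hlip s hs p.1 hp.1 p.2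

/-! ### Characteristics -/

/-- `X` is a characteristic of the velocity field `u` on `[0,τ]`. -/
structure IsCharacteristic (τ : ℝ) (u : ℝ → ℝ → ℝ) (X : ℝ → ℝ) : Prop where
  cont : ContinuousOn X (Icc 0 τ)
  velocity : ∀ t ∈ Ioo 0 τ, HasDerivAt X (u t (X t)) t

/-- Boundedness of u and uₓ on [0,τ] × ℝ lets one application of Picard–Lindelöf cover the whole
interval: speed at most M keeps the curve within Mτ of its starting point. The base time is
arbitrary, so characteristics can also be traced backwards. -/
theorem exists_characteristic {T τ : ℝ} {u : ℝ → ℝ → ℝ} (hu : IsClassC1 T u) (hτ : τ < T)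
    {t₀ : ℝ} (ht₀ : t₀ ∈ Icc 0 τ) (x₀ : ℝ) : ∃ X, IsCharacteristic τ u X ∧ X t₀ = x₀ := by
  obtain ⟨M, hM0, hM⟩ := hu.exists_bound hτ
  have hsub : Icc 0 τ ⊆ Ico 0 T := fun t ht => ⟨ht.1, ht.2.trans_lt hτ⟩
  have hτ0 : 0 ≤ τ := ht₀.1.trans ht₀.2
  have hpl : IsPicardLindelof u (⟨t₀, ht₀⟩ : Icc 0 τ) x₀ (M * τ).toNNReal 0 M.toNNReal
      M.toNNReal := by
    refine ⟨fun t ht => ?_, fun x _ => (hu.continuousOn_time x).mono hsub, fun t ht x _ => ?_, ?_⟩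
    · refine LipschitzOnWith.of_dist_le_mul fun x _ y _ => ?_
      rw [Real.coe_toNNReal _ hM0]
      exact hu.lipschitz_space (hsub ht) (fun z => (hM t ht z).2.1) x y
    · rw [Real.coe_toNNReal _ hM0]
      exact (hM t ht x).1
    · rw [Real.coe_toNNReal _ hM0, Real.coe_toNNReal _ (by positivity), NNReal.coe_zero, sub_zero,
        sub_zero]
      refine mul_le_mul_of_nonneg_left (max_le ?_ ?_) hM0
      · simpa using ht₀.1
      · simpa using ht₀.2
  obtain ⟨X, hX0, hX⟩ := hpl.exists_eq_forall_mem_Icc_hasDerivWithinAt₀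
  exact ⟨X, ⟨fun t ht => (hX t ht).continuousWithinAt, fun t ht =>
    (hX t (Ioo_subset_Icc_self ht)).hasDerivAt (Icc_mem_nhds ht.1 ht.2)⟩, hX0⟩

/-- Two characteristics do not cross, and separate at most exponentially. -/
theorem IsCharacteristic.gap {T τ M : ℝ} {u : ℝ → ℝ → ℝ} {X Y : ℝ → ℝ} (hu : IsClassC1 T u)
    (hτ : τ < T) (hM : ∀ t ∈ Icc 0 τ, ∀ x, |deriv (u t) x| ≤ M)
    (hX : IsCharacteristic τ u X) (hY : IsCharacteristic τ u Y) (h0 : X 0 < Y 0)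
    {t : ℝ} (ht : t ∈ Icc 0 τ) :
    X t < Y t ∧ Y t - X t ≤ (Y 0 - X 0) * Real.exp (M * t) := by
  have hτ0 : 0 ≤ τ := ht.1.trans ht.2
  set g : ℝ → ℝ := fun t => Y t - X t
  have hgc : ContinuousOn g (Icc 0 τ) := hY.cont.sub hX.cont
  have hgd : ∀ t ∈ Ioo 0 τ, HasDerivAt g (u t (Y t) - u t (X t)) t := fun t ht =>
    (hY.velocity t ht).sub (hX.velocity t ht)
  have hb : ∀ t ∈ Ioo 0 τ, |g t * (u t (Y t) - u t (X t))| ≤ M * g t ^ 2 := by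
    intro t ht
    have := hu.lipschitz_space ⟨ht.1.le, ht.2.trans hτ⟩ (hM t (Ioo_subset_Icc_self ht)) (Y t) (X t)
    rw [abs_mul, ← sq_abs (g t)]
    have h2 := mul_le_mul_of_nonneg_left this (abs_nonneg (g t))
    calc _ ≤ _ := h2
      _ = M * |g t| ^ 2 := by simp only [g]; ring
  have hd : ∀ (c t : ℝ), t ∈ Ioo 0 τ → HasDerivAt (fun t => g t ^ 2 * Real.exp (c * t))
      ((2 * (g t * (u t (Y t) - u t (X t))) + c * g t ^ 2) * Real.exp (c * t)) t := by
    intro c t ht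
    have he : HasDerivAt (fun t => Real.exp (c * t)) (Real.exp (c * t) * c) t := by
      simpa using ((hasDerivAt_id t).const_mul c).exp
    refine (((hgd t ht).pow 2).mul he).congr_deriv ?_
    simp
    ring
  -- Since |g g'| ≤ M g², the square of the gap cannot shrink faster than e^(-2Mt), hence never
  -- vanishes; the antitone companion below gives the upper bound.
  have hmono : MonotoneOn (fun t => g t ^ 2 * Real.exp (2 * M * t)) (Icc 0 τ) := by
    refine monotoneOn_of_hasDerivWithinAt_nonneg (convex_Icc 0 τ) (by fun_prop)
      (fun t ht => (hd (2 * M) t (by rwa [interior_Icc] at ht)).hasDerivWithinAt) fun t ht => ?_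
    rw [interior_Icc] at ht
    have := (abs_le.1 (hb t ht)).1
    exact mul_nonneg (by linarith) (Real.exp_pos _).le
  have hanti : AntitoneOn (fun t => g t ^ 2 * Real.exp (-2 * M * t)) (Icc 0 τ) := by
    refine antitoneOn_of_hasDerivWithinAt_nonpos (convex_Icc 0 τ) (by fun_prop)
      (fun t ht => (hd (-2 * M) t (by rwa [interior_Icc] at ht)).hasDerivWithinAt) fun t ht => ?_
    rw [interior_Icc] at ht
    have := (abs_le.1 (hb t ht)).2
    exact mul_nonpos_of_nonpos_of_nonneg (by linarith) (Real.exp_pos _).le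
  have hg0 : 0 < g 0 := sub_pos.2 h0
  have hne : ∀ s ∈ Icc 0 τ, g s ≠ 0 := by
    intro s hs h
    have := hmono (left_mem_Icc.2 hτ0) hs hs.1
    simp only [h, mul_zero, Real.exp_zero, mul_one] at this
    nlinarith
  have hpos : 0 < g t := by
    by_contra! hneg
    obtain ⟨s, hs, hs0⟩ := intermediate_value_Icc' ht.1 (hgc.mono (Icc_subset_Icc_right ht.2))
      ⟨hneg, hg0.le⟩
    exact hne s ⟨hs.1, hs.2.trans ht.2⟩ hs0
  refine ⟨sub_pos.1 hpos, ?_⟩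
  have h1 := hanti (left_mem_Icc.2 hτ0) ht ht.1
  simp only [mul_zero, Real.exp_zero, mul_one] at h1
  have h2 : g t ^ 2 ≤ (g 0 * Real.exp (M * t)) ^ 2 := by
    rw [mul_pow, ← Real.exp_nat_mul]
    rw [show -2 * M * t = -(2 * M * t) by ring, Real.exp_neg, ← div_eq_mul_inv,
      div_le_iff₀ (Real.exp_pos _)] at h1
    rwa [show ((2 : ℕ) : ℝ) * (M * t) = 2 * M * t by push_cast; ring]
  exact abs_le_of_sq_le_sq' h2 (by positivity) |>.2

theorem hasDerivAt_primitive {d : ℝ → ℝ} {τ : ℝ} (hd : ContinuousOn d (Icc 0 τ)) {t : ℝ}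
    (ht : t ∈ Ioo 0 τ) : HasDerivAt (fun t => ∫ s in (0 : ℝ)..t, d s) (d t) t := by
  have hsub : uIcc 0 t ⊆ Icc 0 τ := by
    rw [uIcc_of_le ht.1.le]
    exact Icc_subset_Icc_right ht.2.le
  refine intervalIntegral.integral_hasDerivAt_right (hd.mono hsub).intervalIntegrable
    ((hd.mono Ioo_subset_Icc_self).stronglyMeasurableAtFilter isOpen_Ioo t ht)
    (hd.continuousAt (Icc_mem_nhds ht.1 ht.2))

theorem continuousOn_primitive_Icc {d : ℝ → ℝ} {τ : ℝ} (hτ : 0 ≤ τ)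
    (hd : ContinuousOn d (Icc 0 τ)) :
    ContinuousOn (fun t => ∫ s in (0 : ℝ)..t, d s) (Icc 0 τ) := by
  have := intervalIntegral.continuousOn_primitive_interval' (μ := volume) (a := 0) (b₁ := 0)
    (b₂ := τ) (f := d) (by
      apply ContinuousOn.intervalIntegrable
      rwa [uIcc_of_le hτ]) left_mem_uIcc
  rwa [uIcc_of_le hτ] at this

/-- The factor by which the flow stretches lengths along the curve `X`. -/
def stretch (u : ℝ → ℝ → ℝ) (X : ℝ → ℝ) (t : ℝ) : ℝ :=
  Real.exp (∫ s in (0 : ℝ)..t, deriv (u s) (X s))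

theorem stretch_zero (u : ℝ → ℝ → ℝ) (X : ℝ → ℝ) : stretch u X 0 = 1 := by simp [stretch]

theorem stretch_pos (u : ℝ → ℝ → ℝ) (X : ℝ → ℝ) (t : ℝ) : 0 < stretch u X t := Real.exp_pos _

section

variable {T τ : ℝ} {ρ₀ u₀ : ℝ → ℝ} {ρ u φ : ℝ → ℝ → ℝ} {X : ℝ → ℝ}

theorem Icc_subset_of_lt (hτ : τ < T) : Icc 0 τ ⊆ Ico 0 T := fun _ ht => ⟨ht.1, ht.2.trans_lt hτ⟩

theorem continuousOn_stretch (hu : IsClassC1 T u) (hτ0 : 0 ≤ τ) (hτ : τ < T)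
    (hX : IsCharacteristic τ u X) : ContinuousOn (stretch u X) (Icc 0 τ) :=
  (continuousOn_primitive_Icc hτ0
    (hu.continuousOn_deriv_along (Icc_subset_of_lt hτ) hX.cont)).rexp

theorem hasDerivAt_stretch (hu : IsClassC1 T u) (hτ : τ < T)
    (hX : IsCharacteristic τ u X) {t : ℝ} (ht : t ∈ Ioo 0 τ) :
    HasDerivAt (stretch u X) (deriv (u t) (X t) * stretch u X t) t := by
  have := (hasDerivAt_primitive
    (hu.continuousOn_deriv_along (Icc_subset_of_lt hτ) hX.cont) ht).exp
  exact this.congr_deriv (mul_comm _ _)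

/-- Conservation of mass in Lagrangian form: along X the density satisfies ρ' = -uₓ ρ, while the
stretching factor satisfies y' = uₓ y. -/
theorem IsClassicalSolution.density_mul_stretch (h : IsClassicalSolution T ρ₀ u₀ ρ u φ)
    (hτ : τ < T) (hX : IsCharacteristic τ u X) {t : ℝ} (ht : t ∈ Icc 0 τ) :
    ρ t (X t) * stretch u X t = ρ₀ (X 0) := by
  have hτ0 : 0 ≤ τ := ht.1.trans ht.2
  have hc : ContinuousOn (fun t => ρ t (X t) * stretch u X t) (Icc 0 τ) :=
    (h.density_C1.continuousOn_along (Icc_subset_of_lt hτ) hX.cont).mul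
      (continuousOn_stretch h.velocity_C1 hτ0 hτ hX)
  have hd : ∀ s ∈ Ioo 0 τ, HasDerivAt (fun t => ρ t (X t) * stretch u X t) 0 s := by
    intro s hs
    have hs' : s ∈ Ioo 0 T := ⟨hs.1, hs.2.trans hτ⟩
    have hs'' : s ∈ Ico 0 T := ⟨hs.1.le, hs'.2⟩
    have h1 := (h.density_C1.hasDerivAt_along hs' (hX.velocity s hs)).mul
      (hasDerivAt_stretch h.velocity_C1 hτ hX hs)
    refine h1.congr_deriv ?_
    have h2 := h.continuity s hs' (X s)
    have h3 : deriv (fun y => ρ s y * u s y) (X s) = _ :=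
      ((h.density_C1.hasDerivAt_space hs'' (X s)).mul
        (h.velocity_C1.hasDerivAt_space hs'' (X s))).deriv
    rw [h3] at h2
    linear_combination stretch u X s * h2
  have hd' : ∀ s ∈ interior (Icc 0 τ), HasDerivWithinAt (fun t => ρ t (X t) * stretch u X t) 0
      (interior (Icc 0 τ)) s := fun s hs =>
    (hd s (by rwa [interior_Icc] at hs)).hasDerivWithinAt
  have h1 := monotoneOn_of_hasDerivWithinAt_nonneg (convex_Icc 0 τ) hc hd' (fun _ _ => le_rfl)
    (left_mem_Icc.2 hτ0) ht ht.1
  have h2 := antitoneOn_of_hasDerivWithinAt_nonpos (convex_Icc 0 τ) hc hd' (fun _ _ => le_rfl)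
    (left_mem_Icc.2 hτ0) ht ht.1
  have h3 := le_antisymm h2 h1
  simp only [stretch_zero, mul_one, h.density_init] at h3
  exact h3

theorem IsClassicalSolution.density_nonneg (h : IsClassicalSolution T ρ₀ u₀ ρ u φ)
    (hρ₀ : ∀ x, 0 ≤ ρ₀ x) {t : ℝ} (ht : t ∈ Ico 0 T) (x : ℝ) : 0 ≤ ρ t x := by
  obtain ⟨X, hX, hXt⟩ := exists_characteristic h.velocity_C1 ht.2 ⟨ht.1, le_rfl⟩ x
  have h1 := h.density_mul_stretch ht.2 hX ⟨ht.1, le_rfl⟩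
  rw [hXt] at h1
  have h2 := hρ₀ (X 0)
  rw [← h1] at h2
  exact nonneg_of_mul_nonneg_left h2 (stretch_pos u X t)

end

/-! ### Energy bounds for the potential -/

theorem continuous_U : Continuous U := by
  unfold U
  fun_prop

theorem U_nonneg (r : ℝ) : 0 ≤ U r := by
  have h1 := Real.add_one_le_exp (-r)
  have h2 : Real.exp r * Real.exp (-r) = 1 := by rw [← Real.exp_add]; simp
  have h3 := mul_le_mul_of_nonneg_left h1 (Real.exp_pos r).le
  unfold U
  linarith

theorem U_pos {r : ℝ} (hr : r ≠ 0) : 0 < U r := by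
  have h1 := Real.add_one_lt_exp (neg_ne_zero.2 hr)
  have h2 : Real.exp r * Real.exp (-r) = 1 := by rw [← Real.exp_add]; simp
  have h3 := mul_lt_mul_of_pos_left h1 (Real.exp_pos r)
  unfold U
  linarith

theorem hasDerivAt_Vplus (z : ℝ) : HasDerivAt Vplus √(2 * U z) z := by
  have hc : Continuous fun r => √(2 * U r) := by
    have := continuous_U
    fun_prop
  exact intervalIntegral.integral_hasDerivAt_right (hc.intervalIntegrable _ _)
    (hc.stronglyMeasurableAtFilter _ _) hc.continuousAt

theorem continuous_Vplus : Continuous Vplus :=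
  continuous_iff_continuousAt.2 fun z => (hasDerivAt_Vplus z).continuousAt

theorem Vplus_zero : Vplus 0 = 0 := by simp [Vplus]

theorem Vminus_eq (z : ℝ) : Vminus z = -Vplus z := intervalIntegral.integral_symm _ _

theorem strictMonoOn_Vplus_of_interior {D : Set ℝ} (hD : Convex ℝ D)
    (h0 : ∀ x ∈ interior D, x ≠ 0) : StrictMonoOn Vplus D :=
  strictMonoOn_of_hasDerivWithinAt_pos hD continuous_Vplus.continuousOn
    (fun z _ => (hasDerivAt_Vplus z).hasDerivWithinAt)
    fun z hz => Real.sqrt_pos.2 (by linarith [U_pos (h0 z hz)])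

theorem strictMonoOn_Vplus_Ici : StrictMonoOn Vplus (Ici 0) :=
  strictMonoOn_Vplus_of_interior (convex_Ici 0) fun x hx => by
    rw [interior_Ici] at hx
    exact (mem_Ioi.1 hx).ne'

theorem strictMonoOn_Vplus_Iic : StrictMonoOn Vplus (Iic 0) :=
  strictMonoOn_Vplus_of_interior (convex_Iic 0) fun x hx => by
    rw [interior_Iic] at hx
    exact (mem_Iio.1 hx).ne

theorem monotoneOn_Vplus_sub {D : Set ℝ} (hD : Convex ℝ D) (h : ∀ x ∈ D, 1 ≤ 2 * U x) :
    MonotoneOn (fun z => Vplus z - z) D :=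
  monotoneOn_of_hasDerivWithinAt_nonneg hD (continuous_Vplus.sub continuous_id).continuousOn
    (fun z _ => ((hasDerivAt_Vplus z).sub (hasDerivAt_id z)).hasDerivWithinAt)
    fun z hz => by
      have := Real.one_le_sqrt.2 (h z (interior_subset hz))
      linarith

/-- Surjectivity holds because U ≥ 1 on [1,∞), so the integral grows at least linearly there. It
makes the `Function.invFunOn` in `cplus` a genuine inverse rather than a default value. -/
theorem exists_Vplus_eq {H : ℝ} (hH : 0 ≤ H) : ∃ z ∈ Ici (0 : ℝ), Vplus z = H := by
  have h1 : MonotoneOn (fun z => Vplus z - z) (Ici 1) :=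
    monotoneOn_Vplus_sub (convex_Ici 1) fun x hx => by
      have : 0 ≤ (x - 1) * Real.exp x :=
        mul_nonneg (by linarith [mem_Ici.1 hx]) (Real.exp_pos x).le
      unfold U
      linarith
  have h2 := h1 (self_mem_Ici) (show 1 + H ∈ Ici (1 : ℝ) by simpa using hH) (by linarith)
  have h3 : Vplus 0 < Vplus 1 := strictMonoOn_Vplus_Ici (by simp) (by simp) one_pos
  rw [Vplus_zero] at h3
  simp only at h2
  obtain ⟨z, hz, hzH⟩ := intermediate_value_Icc (show (0 : ℝ) ≤ 1 + H by linarith)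
    continuous_Vplus.continuousOn ⟨Vplus_zero.trans_le hH, show H ≤ Vplus (1 + H) by linarith⟩
  exact ⟨z, hz.1, hzH⟩

theorem exists_Vminus_eq {H : ℝ} (hH : 0 ≤ H) : ∃ z ∈ Iic (0 : ℝ), Vminus z = H := by
  have h1 : MonotoneOn (fun z => Vplus z - z) (Iic (-3)) :=
    monotoneOn_Vplus_sub (convex_Iic (-3)) fun x hx => by
      have hx : x ≤ -3 := hx
      have h2 := Real.quadratic_le_exp_of_nonneg (show 0 ≤ -x by linarith)
      -- The cut-off -3 ensures 1 - x ≤ x²/2, so e^(-x) ≥ 1 - x + x²/2 gives 2(1 - x)e^x ≤ 1, that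
      -- is 2U ≥ 1.
      have h3 : Real.exp x * Real.exp (-x) = 1 := by rw [← Real.exp_add]; simp
      have h4 := mul_le_mul_of_nonneg_left h2 (Real.exp_pos x).le
      have h5 : 0 ≤ Real.exp x * (x ^ 2 / 2 + x - 1) :=
        mul_nonneg (Real.exp_pos x).le (by nlinarith)
      unfold U
      nlinarith
  have h2 := h1 (show -3 - H ∈ Iic (-3 : ℝ) by simpa using hH) (show (-3 : ℝ) ∈ Iic (-3) by simp)
    (by linarith)
  have h3 : Vplus (-3) < Vplus 0 := strictMonoOn_Vplus_Iic (by simp) (by simp) (by norm_num)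
  rw [Vplus_zero] at h3
  simp only at h2
  obtain ⟨z, hz, hzH⟩ := intermediate_value_Icc (show -3 - H ≤ (0 : ℝ) by linarith)
    continuous_Vplus.continuousOn (show -H ∈ Icc (Vplus (-3 - H)) (Vplus 0) from
      ⟨by linarith, by rw [Vplus_zero]; linarith⟩)
  exact ⟨z, hz.2, by rw [Vminus_eq, hzH, neg_neg]⟩

theorem exp_le_cplus {H a : ℝ} (hH : 0 ≤ H) (ha : Vplus a ≤ H) : Real.exp a ≤ cplus H := by
  have h1 := Function.invFunOn_mem (exists_Vplus_eq hH)
  have h2 := Function.invFunOn_eq (exists_Vplus_eq hH)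
  refine Real.exp_le_exp.2 ?_
  by_contra! hlt
  have := strictMonoOn_Vplus_Ici h1 (mem_Ici.2 ((mem_Ici.1 h1).trans hlt.le)) hlt
  linarith

theorem cminus_le_exp {H a : ℝ} (hH : 0 ≤ H) (ha : -H ≤ Vplus a) : cminus H ≤ Real.exp a := by
  have h1 := Function.invFunOn_mem (exists_Vminus_eq hH)
  have h2 := Function.invFunOn_eq (exists_Vminus_eq hH)
  rw [Vminus_eq] at h2
  refine Real.exp_le_exp.2 ?_
  by_contra! hlt
  have := strictMonoOn_Vplus_Iic (mem_Iic.2 (hlt.le.trans (mem_Iic.1 h1))) h1 hlt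
  linarith

/-- A potential of energy at most `H` satisfies `|V(φ)| ≤ H`. -/
theorem IsPotential.abs_Vplus_le {ρ φ : ℝ → ℝ} (h : IsPotential ρ φ) {H : ℝ}
    (hH : ∀ ε > 0, ∀ᶠ R in atTop,
      ∫ x in (-R)..R, (1 / 2 * deriv φ x ^ 2 + U (φ x)) ≤ H + ε) (x : ℝ) :
    |Vplus (φ x)| ≤ H := by
  set e : ℝ → ℝ := fun x => 1 / 2 * deriv φ x ^ 2 + U (φ x)
  have hec : Continuous e := by
    have h1 := continuous_U.comp h.continuous
    have h2 := h.continuous_deriv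
    exact (continuous_const.mul (h2.pow 2)).add h1
  have he0 : ∀ x, 0 ≤ e x := fun x => add_nonneg (by positivity) (U_nonneg _)
  have hV : ∀ y, HasDerivAt (fun y => Vplus (φ y)) (√(2 * U (φ y)) * deriv φ y) y := fun y =>
    (hasDerivAt_Vplus (φ y)).comp y (h.hasDerivAt y)
  -- Young's inequality is what makes V₊(φ) the quantity controlled by the energy.
  have hVb : ∀ y, |√(2 * U (φ y)) * deriv φ y| ≤ e y := by
    intro y
    have h1 : √(2 * U (φ y)) ^ 2 = 2 * U (φ y) := Real.sq_sqrt (by linarith [U_nonneg (φ y)])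
    simp only [e]
    refine abs_le.2 ⟨?_, ?_⟩
    · nlinarith [sq_nonneg (√(2 * U (φ y)) + deriv φ y)]
    · nlinarith [sq_nonneg (√(2 * U (φ y)) - deriv φ y)]
  have key : ∀ R, |x| ≤ R → |Vplus (φ x) - Vplus (φ (-R))| ≤ ∫ x in (-R)..R, e x := by
    intro R hR
    have hx1 : -R ≤ x := (abs_le.1 hR).1
    have hint : ∀ a b, IntervalIntegrable e volume a b := fun a b => hec.intervalIntegrable a b
    have h1 : Vplus (φ x) - Vplus (φ (-R)) = ∫ y in (-R)..x, √(2 * U (φ y)) * deriv φ y := by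
      refine (intervalIntegral.integral_eq_sub_of_hasDerivAt (fun y _ => hV y) ?_).symm
      apply Continuous.intervalIntegrable
      have h3 := continuous_U.comp h.continuous
      exact ((continuous_const.mul h3).sqrt).mul h.continuous_deriv
    rw [h1]
    refine (intervalIntegral.abs_integral_le_integral_abs hx1).trans ?_
    have hc : Continuous fun y => |√(2 * U (φ y)) * deriv φ y| := by
      have h3 := continuous_U.comp h.continuous
      exact (((continuous_const.mul h3).sqrt).mul h.continuous_deriv).abs
    refine (intervalIntegral.integral_mono_on hx1 (hc.intervalIntegrable _ _) (hint _ _)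
      fun y _ => hVb y).trans ?_
    rw [← intervalIntegral.integral_add_adjacent_intervals (hint (-R) x) (hint x R)]
    have := intervalIntegral.integral_nonneg (μ := volume) (abs_le.1 hR).2 fun y _ => he0 y
    linarith
  refine le_of_forall_pos_le_add fun ε hε => ?_
  have hlim : Tendsto (fun R : ℝ => |Vplus (φ x) - Vplus (φ (-R))|) atTop
      (𝓝 |Vplus (φ x) - Vplus 0|) := by
    have h1 : Tendsto (fun R : ℝ => φ (-R)) atTop (𝓝 0) :=
      h.decay.comp (tendsto_neg_atTop_atBot.mono_right atBot_le_cocompact)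
    exact (tendsto_const_nhds.sub ((continuous_Vplus.tendsto 0).comp h1)).abs
  rw [Vplus_zero, sub_zero] at hlim
  refine le_of_tendsto hlim ?_
  filter_upwards [hH ε hε, eventually_ge_atTop |x|] with R h1 h2
  exact (key R h2).trans h1

/-! ### The energy inequality -/

/-- Integration of a one-sided differential inequality given by upper supporting functions. -/
theorem le_add_mul_of_supporting {f : ℝ → ℝ} {a b κ : ℝ} (hab : a < b)
    (hf : ContinuousOn f (Icc a b))
    (hd : ∀ s ∈ Ioo a b, ∃ g c, HasDerivAt g c s ∧ c ≤ κ ∧ g s = f s ∧ ∀ t ∈ Ioo s b, f t ≤ g t) :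
    f b ≤ f a + κ * (b - a) := by
  -- Supporting functions exist only at interior times, so integration starts at a' > a and
  -- continuity then lets a' tend to a.
  have key : ∀ a' ∈ Ioo a b, f b ≤ f a' + κ * (b - a') := by
    intro a' ha'
    refine image_le_of_liminf_slope_right_le_deriv_boundary
      (B := fun x => f a' + κ * (x - a')) (B' := fun _ => κ)
      (hf.mono (Icc_subset_Icc_left ha'.1.le)) (by simp) (by fun_prop) ?_ ?_
      (right_mem_Icc.2 ha'.2.le)
    · intro x _
      have := (((hasDerivAt_id x).sub_const a').const_mul κ).const_add (f a')
      exact (this.congr_deriv (by simp)).hasDerivWithinAt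
    · intro s hs r hr
      obtain ⟨g, c, hg, hc, hgs, hle⟩ := hd s ⟨ha'.1.trans_le hs.1, hs.2⟩
      have h2 := (hasDerivAt_iff_tendsto_slope.1 hg).mono_left
        (nhdsWithin_mono s fun y (hy : s < y) => hy.ne')
      refine Eventually.frequently ?_
      filter_upwards [h2.eventually (gt_mem_nhds (hc.trans_lt hr)), Ioo_mem_nhdsGT hs.2] with z h3 h4
      refine lt_of_le_of_lt ?_ h3
      rw [slope_def_field, slope_def_field, hgs]
      have := hle z h4
      have h5 : 0 ≤ z - s := sub_nonneg.2 h4.1.le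
      gcongr
  have hlim : Tendsto (fun a' => f a' + κ * (b - a')) (𝓝[>] a) (𝓝 (f a + κ * (b - a))) := by
    have h1 : Tendsto f (𝓝[>] a) (𝓝 (f a)) := by
      have := hf a (left_mem_Icc.2 hab.le)
      exact this.mono_left (nhdsWithin_le_of_mem (mem_of_superset (Ioo_mem_nhdsGT hab)
        Ioo_subset_Icc_self))
    have h2 : Continuous fun a' => κ * (b - a') := by fun_prop
    exact h1.add ((h2.tendsto a).mono_left nhdsWithin_le_nhds)
  exact ge_of_tendsto hlim (by filter_upwards [Ioo_mem_nhdsGT hab] with c hc using key c hc)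

/-- Differentiation under the integral sign for an integrand that is Lipschitz in time. -/
theorem hasDerivAt_integral_of_lipschitz_time {F : ℝ → ℝ → ℝ} {F' : ℝ → ℝ} {τ C a b s : ℝ}
    (hs : s ∈ Ioo 0 τ) (hcont : ∀ t ∈ Icc 0 τ, Continuous (F t))
    (hlip : ∀ s ∈ Icc 0 τ, ∀ t ∈ Icc 0 τ, ∀ x, |F t x - F s x| ≤ C * |t - s|)
    (hd : ∀ x, HasDerivAt (fun t => F t x) (F' x) s) (hF' : Continuous F') :
    HasDerivAt (fun t => ∫ x in a..b, F t x) (∫ x in a..b, F' x) s := by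
  have hnhds : Icc 0 τ ∈ 𝓝 s := Icc_mem_nhds hs.1 hs.2
  refine (intervalIntegral.hasDerivAt_integral_of_dominated_loc_of_lip (bound := fun _ => C)
    hnhds ?_ ((hcont s (Ioo_subset_Icc_self hs)).intervalIntegrable _ _)
    hF'.aestronglyMeasurable ?_ intervalIntegrable_const (Eventually.of_forall fun x _ => hd x)).2
  · filter_upwards [hnhds] with t ht
    exact (hcont t ht).aestronglyMeasurable
  · refine Eventually.of_forall fun x _ => LipschitzOnWith.of_dist_le_mul fun t ht r hr => ?_
    rw [Real.dist_eq, Real.dist_eq, Real.coe_nnabs]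
    exact (hlip r hr t ht x).trans (mul_le_mul_of_nonneg_right (le_abs_self C) (abs_nonneg _))

theorem lipschitz_time_mul {f g : ℝ → ℝ → ℝ} {τ A B L M : ℝ}
    (hf : ∀ t ∈ Icc 0 τ, ∀ x, |f t x| ≤ A) (hg : ∀ t ∈ Icc 0 τ, ∀ x, |g t x| ≤ B)
    (hfl : ∀ s ∈ Icc 0 τ, ∀ t ∈ Icc 0 τ, ∀ x, |f t x - f s x| ≤ L * |t - s|)
    (hgl : ∀ s ∈ Icc 0 τ, ∀ t ∈ Icc 0 τ, ∀ x, |g t x - g s x| ≤ M * |t - s|) :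
    ∀ s ∈ Icc 0 τ, ∀ t ∈ Icc 0 τ, ∀ x,
      |f t x * g t x - f s x * g s x| ≤ (A * M + B * L) * |t - s| := by
  intro s hs t ht x
  have hA : 0 ≤ A := (abs_nonneg _).trans (hf t ht x)
  have hB : 0 ≤ B := (abs_nonneg _).trans (hg t ht x)
  calc |f t x * g t x - f s x * g s x|
      = |f t x * (g t x - g s x) + g s x * (f t x - f s x)| := by ring_nf
    _ ≤ |f t x| * |g t x - g s x| + |g s x| * |f t x - f s x| := by
      rw [← abs_mul, ← abs_mul]; exact abs_add_le _ _
    _ ≤ A * (M * |t - s|) + B * (L * |t - s|) := by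
      gcongr
      · exact hf t ht x
      · exact hgl s hs t ht x
      · exact hg s hs x
      · exact hfl s hs t ht x
    _ = (A * M + B * L) * |t - s| := by ring

/-- Uniform bounds for a solution on `[0,τ] × ℝ`. -/
structure UniformBounds (τ C : ℝ) (ρ u φ : ℝ → ℝ → ℝ) : Prop where
  nonneg : 0 ≤ C
  density : ∀ t ∈ Icc 0 τ, ∀ x, |ρ t x| ≤ C
  velocity : ∀ t ∈ Icc 0 τ, ∀ x, |u t x| ≤ C
  velocity_deriv : ∀ t ∈ Icc 0 τ, ∀ x, |deriv (u t) x| ≤ C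
  potential : ∀ t ∈ Icc 0 τ, ∀ x, |φ t x| ≤ C
  field : ∀ t ∈ Icc 0 τ, ∀ x, |deriv (φ t) x| ≤ C
  density_lip : ∀ s ∈ Icc 0 τ, ∀ t ∈ Icc 0 τ, ∀ x, |ρ t x - ρ s x| ≤ C * |t - s|
  velocity_lip : ∀ s ∈ Icc 0 τ, ∀ t ∈ Icc 0 τ, ∀ x, |u t x - u s x| ≤ C * |t - s|
  potential_lip : ∀ s ∈ Icc 0 τ, ∀ t ∈ Icc 0 τ, ∀ x, |φ t x - φ s x| ≤ C * |t - s|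
  field_lip : ∀ s ∈ Icc 0 τ, ∀ t ∈ Icc 0 τ, ∀ x,
    |deriv (φ t) x - deriv (φ s) x| ≤ C * |t - s|

section

variable {T τ C : ℝ} {ρ₀ u₀ : ℝ → ℝ} {ρ u φ : ℝ → ℝ → ℝ}

theorem IsClassicalSolution.exists_uniformBounds (h : IsClassicalSolution T ρ₀ u₀ ρ u φ)
    (hτ : τ < T) : ∃ C, UniformBounds τ C ρ u φ := by
  obtain ⟨M, hM0, hM⟩ := h.density_C1.exists_bound hτ
  obtain ⟨N, hN0, hN⟩ := h.velocity_C1.exists_bound hτ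
  have hρl : ∀ s ∈ Icc 0 τ, ∀ t ∈ Icc 0 τ, ∀ x, |ρ t x - ρ s x| ≤ M * |t - s| :=
    fun s hs t ht x => h.density_C1.lipschitz_time hτ (fun t ht x => (hM t ht x).2.2) hs ht x
  have hul : ∀ s ∈ Icc 0 τ, ∀ t ∈ Icc 0 τ, ∀ x, |u t x - u s x| ≤ N * |t - s| :=
    fun s hs t ht x => h.velocity_C1.lipschitz_time hτ (fun t ht x => (hN t ht x).2.2) hs ht x
  obtain ⟨B, hB0, hB1, hB2, hB3⟩ := exists_potential_bounds hM0 (fun t ht x => (hM t ht x).1) hρl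
    fun t ht => h.potential t (Icc_subset_of_lt hτ ht)
  have h1 : M ≤ M + N + B := by linarith
  have h2 : N ≤ M + N + B := by linarith
  have h3 : B ≤ M + N + B := by linarith
  have mono : ∀ {K a : ℝ}, K ≤ M + N + B → K * |a| ≤ (M + N + B) * |a| := fun hK =>
    mul_le_mul_of_nonneg_right hK (abs_nonneg _)
  exact ⟨M + N + B, by positivity, fun t ht x => (hM t ht x).1.trans h1,
    fun t ht x => (hN t ht x).1.trans h2, fun t ht x => (hN t ht x).2.1.trans h2,
    fun t ht x => (hB1 t ht x).1.trans h3, fun t ht x => (hB1 t ht x).2.trans h3,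
    fun s hs t ht x => (hρl s hs t ht x).trans (mono h1),
    fun s hs t ht x => (hul s hs t ht x).trans (mono h2),
    fun s hs t ht x => (hB2 s hs t ht x).trans (mono h3),
    fun s hs t ht x => (hB3 s hs t ht x).trans (mono h3)⟩

theorem IsPotential.continuous_density {ρ φ : ℝ → ℝ} (h : IsPotential ρ φ) : Continuous ρ := by
  have h1 : ContDiff ℝ 1 (deriv φ) :=
    (contDiff_succ_iff_deriv.1 (show ContDiff ℝ (1 + 1) φ by
      rw [one_add_one_eq_two]; exact h.contDiff)).2.2
  have h2 : Continuous (deriv (deriv φ)) := h1.continuous_deriv le_rfl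
  have h3 : ρ = fun x => Real.exp (φ x) - deriv (deriv φ) x := by
    funext x
    linarith [h.poisson x]
  rw [h3]
  have := h.continuous
  fun_prop

/-- Convexity estimate for the change of the potential energy between two times. -/
theorem potential_energy_sub_le (a b p q : ℝ) :
    (1 / 2 * p ^ 2 + U a) - (1 / 2 * q ^ 2 + U b)
      ≤ p * (p - q) + a * (Real.exp a - Real.exp b) := by
  have h1 := Real.add_one_le_exp (a - b)
  have h2 : Real.exp a = Real.exp b * Real.exp (a - b) := by rw [← Real.exp_add]; ring_nf
  have h3 := mul_le_mul_of_nonneg_left h1 (Real.exp_pos b).le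
  rw [← h2] at h3
  unfold U
  nlinarith [sq_nonneg (p - q)]

/-- The pointwise convexity estimate is integrated, and φ₁(φ₁' - φ₂') is differentiated by means of
both Poisson equations; this trades field quantities for the density difference and endpoint terms.
-/
theorem integral_potential_energy_sub_le {ρ₁ ρ₂ φ₁ φ₂ : ℝ → ℝ} (h₁ : IsPotential ρ₁ φ₁)
    (h₂ : IsPotential ρ₂ φ₂) {a b : ℝ} (hab : a ≤ b) :
    (∫ x in a..b, (1 / 2 * deriv φ₁ x ^ 2 + U (φ₁ x)))
        - ∫ x in a..b, (1 / 2 * deriv φ₂ x ^ 2 + U (φ₂ x))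
      ≤ φ₁ b * (deriv φ₁ b - deriv φ₂ b) - φ₁ a * (deriv φ₁ a - deriv φ₂ a)
        + ∫ x in a..b, φ₁ x * (ρ₁ x - ρ₂ x) := by
  have c1 := h₁.continuous
  have c2 := h₂.continuous
  have d1 := h₁.continuous_deriv
  have d2 := h₂.continuous_deriv
  have r1 := h₁.continuous_density
  have r2 := h₂.continuous_density
  have u1 : Continuous fun x => U (φ₁ x) := continuous_U.comp c1
  have u2 : Continuous fun x => U (φ₂ x) := continuous_U.comp c2
  set G : ℝ → ℝ := fun x => deriv φ₁ x * (deriv φ₁ x - deriv φ₂ x)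
    + φ₁ x * ((Real.exp (φ₁ x) - ρ₁ x) - (Real.exp (φ₂ x) - ρ₂ x))
  have hG : Continuous G := by fun_prop
  have hftc : ∫ x in a..b, G x
      = φ₁ b * (deriv φ₁ b - deriv φ₂ b) - φ₁ a * (deriv φ₁ a - deriv φ₂ a) :=
    intervalIntegral.integral_eq_sub_of_hasDerivAt
      (f := fun x => φ₁ x * (deriv φ₁ x - deriv φ₂ x))
      (fun x _ => (h₁.hasDerivAt x).mul ((h₁.hasDerivAt_deriv x).sub (h₂.hasDerivAt_deriv x)))
      (hG.intervalIntegrable _ _)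
  rw [← hftc, ← intervalIntegral.integral_sub, ← intervalIntegral.integral_add]
  · refine intervalIntegral.integral_mono_on hab ?_ ?_ fun x _ => ?_
    · exact Continuous.intervalIntegrable (by fun_prop) _ _
    · exact Continuous.intervalIntegrable (by fun_prop) _ _
    · have := potential_energy_sub_le (φ₁ x) (φ₂ x) (deriv φ₁ x) (deriv φ₂ x)
      simp only [G]
      linarith
  all_goals exact Continuous.intervalIntegrable (by fun_prop) _ _

/-- The flux of the energy, apart from the part carried by the time derivative of the field. -/
def energyFlux (ρ u φ : ℝ → ℝ) (x : ℝ) : ℝ := 1 / 2 * (ρ x * u x ^ 3) + φ x * (ρ x * u x)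

/-- The energy identity, without the part carried by the time derivative of the field. -/
theorem IsClassicalSolution.hasDerivAt_partial_energy (h : IsClassicalSolution T ρ₀ u₀ ρ u φ)
    (hτ : τ < T) (hC : UniformBounds τ C ρ u φ) {s : ℝ} (hs : s ∈ Ioo 0 τ) (a b : ℝ) :
    HasDerivAt (fun t => ∫ x in a..b, (1 / 2 * (ρ t x * (u t x * u t x)) + φ s x * ρ t x))
      (-(energyFlux (ρ s) (u s) (φ s) b - energyFlux (ρ s) (u s) (φ s) a)) s := by
  have hsT : s ∈ Ioo 0 T := ⟨hs.1, hs.2.trans hτ⟩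
  have hsT' : s ∈ Ico 0 T := Ioo_subset_Ico_self hsT
  have hsI : s ∈ Icc 0 τ := Ioo_subset_Icc_self hs
  have hφ := h.potential s hsT'
  set Q' : ℝ → ℝ := fun x =>
    1 / 2 * (deriv (ρ s) x * u s x ^ 3 + ρ s x * (3 * u s x ^ 2 * deriv (u s) x))
      + (deriv (φ s) x * (ρ s x * u s x)
        + φ s x * (deriv (ρ s) x * u s x + ρ s x * deriv (u s) x))
  have hQ : ∀ x, HasDerivAt (energyFlux (ρ s) (u s) (φ s)) (Q' x) x := by
    intro x
    have h1 := h.density_C1.hasDerivAt_space hsT' x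
    have h2 := h.velocity_C1.hasDerivAt_space hsT' x
    refine (((h1.mul (h2.pow 3)).const_mul (1 / 2)).add
      ((hφ.hasDerivAt x).mul (h1.mul h2))).congr_deriv ?_
    simp [Q']
  have hQc : Continuous Q' := by
    have h1 := h.density_C1.continuous_space hsT'
    have h2 := h.velocity_C1.continuous_space hsT'
    have h3 := h.density_C1.continuous_deriv_space hsT'
    have h4 := h.velocity_C1.continuous_deriv_space hsT'
    have h5 := hφ.continuous
    have h6 := hφ.continuous_deriv
    fun_prop
  have hint : -(energyFlux (ρ s) (u s) (φ s) b - energyFlux (ρ s) (u s) (φ s) a)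
      = ∫ x in a..b, -Q' x := by
    rw [intervalIntegral.integral_neg, intervalIntegral.integral_eq_sub_of_hasDerivAt
      (fun x _ => hQ x) (hQc.intervalIntegrable _ _)]
  rw [hint]
  have huu := lipschitz_time_mul hC.velocity hC.velocity hC.velocity_lip hC.velocity_lip
  have hρuu := lipschitz_time_mul (g := fun t x => u t x * u t x) (B := C * C) hC.density
    (fun t ht x => by
      rw [abs_mul]
      exact mul_le_mul (hC.velocity t ht x) (hC.velocity t ht x) (abs_nonneg _) hC.nonneg)
    hC.density_lip huu
  set L := C * (C * C + C * C) + C * C * C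
  refine hasDerivAt_integral_of_lipschitz_time (C := 1 / 2 * L + C * C) hs ?_ ?_ ?_ hQc.neg
  · intro t ht
    have h1 := h.density_C1.continuous_space (Icc_subset_of_lt hτ ht)
    have h2 := h.velocity_C1.continuous_space (Icc_subset_of_lt hτ ht)
    have h5 := hφ.continuous
    fun_prop
  · intro r hr t ht x
    have h1 := hρuu r hr t ht x
    have h2 := mul_le_mul (hC.potential s hsI x) (hC.density_lip r hr t ht x) (abs_nonneg _)
      hC.nonneg
    rw [← abs_mul] at h2
    calc _ = |1 / 2 * (ρ t x * (u t x * u t x) - ρ r x * (u r x * u r x))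
          + φ s x * (ρ t x - ρ r x)| := by ring_nf
      _ ≤ 1 / 2 * |ρ t x * (u t x * u t x) - ρ r x * (u r x * u r x)|
          + |φ s x * (ρ t x - ρ r x)| := by
        refine (abs_add_le _ _).trans_eq ?_
        rw [abs_mul (1 / 2), abs_of_pos (by norm_num : (0 : ℝ) < 1 / 2)]
      _ ≤ (1 / 2 * L + C * C) * |t - r| := by linarith
  · intro x
    have h1 := h.density_C1.hasDerivAt_time hsT x
    have h2 := h.velocity_C1.hasDerivAt_time hsT x
    refine (((h1.mul (h2.mul h2)).const_mul (1 / 2)).add (h1.const_mul (φ s x))).congr_deriv ?_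
    have h3 := h.continuity s hsT x
    have h4 : deriv (fun y => ρ s y * u s y) x = _ :=
      ((h.density_C1.hasDerivAt_space hsT' x).mul
        (h.velocity_C1.hasDerivAt_space hsT' x)).deriv
    have h5 := h.momentum s hsT x
    rw [h4] at h3
    simp only [Q', Pi.mul_apply]
    -- With the potential frozen at time s, the continuity equation is weighted by ½u² + φ and the
    -- momentum equation by ρu; their sum is an exact x-derivative.
    linear_combination (1 / 2 * u s x ^ 2 + φ s x) * h3 + ρ s x * u s x * h5

theorem IsClassicalSolution.continuous_energyDensity (h : IsClassicalSolution T ρ₀ u₀ ρ u φ)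
    {t : ℝ} (ht : t ∈ Ico 0 T) : Continuous (energyDensity (ρ t) (u t) (φ t)) := by
  have h1 := h.density_C1.continuous_space ht
  have h2 := h.velocity_C1.continuous_space ht
  have h3 := (h.potential t ht).continuous_deriv
  have h4 := continuous_U.comp (h.potential t ht).continuous
  exact (((continuous_const.mul h1).mul (h2.pow 2)).add (continuous_const.mul (h3.pow 2))).add h4

theorem IsClassicalSolution.continuousOn_energy (h : IsClassicalSolution T ρ₀ u₀ ρ u φ)
    (hτ : τ < T) (hC : UniformBounds τ C ρ u φ) (a b : ℝ) :
    ContinuousOn (fun t => ∫ x in a..b, energyDensity (ρ t) (u t) (φ t) x) (Icc 0 τ) := by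
  intro s hs
  refine intervalIntegral.continuousWithinAt_of_dominated_interval
    (bound := fun _ => 1 / 2 * C * C ^ 2 + 1 / 2 * C ^ 2 + ((C + 1) * Real.exp C + 1)) ?_ ?_
    intervalIntegrable_const ?_
  · filter_upwards [self_mem_nhdsWithin] with t ht
    exact (h.continuous_energyDensity (Icc_subset_of_lt hτ ht)).aestronglyMeasurable
  · filter_upwards [self_mem_nhdsWithin] with t ht
    refine Eventually.of_forall fun x _ => ?_
    have hC0 := hC.nonneg
    have h1 := hC.density t ht x
    have h2 := hC.velocity t ht x
    have h3 := hC.field t ht x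
    have h4 := hC.potential t ht x
    have h5 : |U (φ t x)| ≤ (C + 1) * Real.exp C + 1 := by
      unfold U
      refine (abs_add_le _ _).trans (add_le_add ?_ (by simp))
      rw [abs_mul, abs_of_pos (Real.exp_pos _)]
      refine mul_le_mul ((abs_sub _ _).trans (by simpa using h4)) (Real.exp_le_exp.2
        ((le_abs_self _).trans h4)) (Real.exp_pos _).le (by linarith)
    rw [Real.norm_eq_abs, energyDensity]
    refine (abs_add_le _ _).trans (add_le_add ((abs_add_le _ _).trans (add_le_add ?_ ?_)) h5)
    · rw [abs_mul, abs_mul, abs_pow, abs_of_pos (by norm_num : (0 : ℝ) < 1 / 2)]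
      gcongr
    · rw [abs_mul, abs_pow, abs_of_pos (by norm_num : (0 : ℝ) < 1 / 2)]
      gcongr
  · refine Eventually.of_forall fun x _ => ?_
    have hsub := Icc_subset_of_lt hτ
    have c1 : ContinuousWithinAt (fun t => ρ t x) (Icc 0 τ) s :=
      (h.density_C1.continuousOn_time x).mono hsub s hs
    have c2 : ContinuousWithinAt (fun t => u t x) (Icc 0 τ) s :=
      (h.velocity_C1.continuousOn_time x).mono hsub s hs
    have cc : ∀ {f : ℝ → ℝ → ℝ}, (∀ s ∈ Icc 0 τ, ∀ t ∈ Icc 0 τ, ∀ x,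
        |f t x - f s x| ≤ C * |t - s|) → ContinuousWithinAt (fun t => f t x) (Icc 0 τ) s := by
      intro f hf
      have : LipschitzOnWith C.toNNReal (fun t => f t x) (Icc 0 τ) :=
        LipschitzOnWith.of_dist_le_mul fun t ht r hr => by
          rw [Real.coe_toNNReal _ hC.nonneg]
          exact hf r hr t ht x
      exact this.continuousOn s hs
    have c3 := cc hC.field_lip
    have c4 := continuous_U.continuousAt.comp_continuousWithinAt (cc hC.potential_lip)
    exact (((continuousWithinAt_const.mul c1).mul (c2.pow 2)).add
      (continuousWithinAt_const.mul (c3.pow 2))).add c4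

theorem abs_energyFlux_le {ρ u φ : ℝ → ℝ} {x η : ℝ} (hC : 0 ≤ C) (hρ : |ρ x| ≤ C) (hu : |u x| ≤ C)
    (hφ : |φ x| ≤ η) (hu' : |u x| ≤ η) :
    |energyFlux ρ u φ x| ≤ (1 / 2 * C ^ 3 + C ^ 2) * η := by
  have hη : 0 ≤ η := (abs_nonneg _).trans hφ
  unfold energyFlux
  refine (abs_add_le _ _).trans ?_
  rw [abs_mul, abs_mul, abs_mul, abs_mul, abs_pow, abs_of_pos (by norm_num : (0 : ℝ) < 1 / 2)]
  calc 1 / 2 * (|ρ x| * |u x| ^ 3) + |φ x| * (|ρ x| * |u x|)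
      = 1 / 2 * (|ρ x| * (|u x| ^ 2 * |u x|)) + |φ x| * (|ρ x| * |u x|) := by ring
    _ ≤ 1 / 2 * (C * (C ^ 2 * η)) + η * (C * C) := by gcongr
    _ = _ := by ring

/-- The energy in `[-R,R]` grows at most at the rate allowed by the boundary terms. -/
theorem IsClassicalSolution.energy_le_add (h : IsClassicalSolution T ρ₀ u₀ ρ u φ) (hτ0 : 0 < τ)
    (hτ : τ < T) (hC : UniformBounds τ C ρ u φ) {R η : ℝ} (hR : 0 ≤ R)
    (hu : ∀ t ∈ Icc 0 τ, |u t R| ≤ η ∧ |u t (-R)| ≤ η)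
    (hφ : ∀ t ∈ Icc 0 τ, |φ t R| ≤ η ∧ |φ t (-R)| ≤ η) :
    ∫ x in (-R)..R, energyDensity (ρ τ) (u τ) (φ τ) x
      ≤ (∫ x in (-R)..R, energyDensity (ρ 0) (u 0) (φ 0) x)
        + (C ^ 3 + 2 * C ^ 2 + 2 * C) * η * τ := by
  have hC0 := hC.nonneg
  have hRR : -R ≤ R := by linarith
  have := le_add_mul_of_supporting hτ0 (h.continuousOn_energy hτ hC (-R) R)
    (κ := (C ^ 3 + 2 * C ^ 2 + 2 * C) * η) ?_
  · simpa using this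
  intro s hs
  have hsI : s ∈ Icc 0 τ := Ioo_subset_Icc_self hs
  set K : ℝ → ℝ := fun t =>
    ∫ x in (-R)..R, (1 / 2 * (ρ t x * (u t x * u t x)) + φ s x * ρ t x)
  have hK := h.hasDerivAt_partial_energy hτ hC hs (-R) R
  set E : ℝ → ℝ := fun t => ∫ x in (-R)..R, energyDensity (ρ t) (u t) (φ t) x
  have hlin : HasDerivAt (fun t : ℝ => t - s) 1 s := (hasDerivAt_id s).sub_const s
  -- Freezing the potential costs at most C²(t-s)² per unit length, a term whose derivative at s is
  -- zero, so the growth rate does not depend on R. The linear term covers the endpoint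
  -- contributions φ(t)(φₓ(t) - φₓ(s)).
  refine ⟨fun t => E s + (K t - K s) + 2 * R * C ^ 2 * (t - s) ^ 2 + 2 * C * η * (t - s), _,
    (((hK.sub_const (K s)).const_add (E s)).add ((hlin.pow 2).const_mul (2 * R * C ^ 2))).add
      (hlin.const_mul (2 * C * η)), ?_, by simp [E], ?_⟩
  · have h1 := abs_le.1 (abs_energyFlux_le hC0 (hC.density s hsI R) (hC.velocity s hsI R)
      (hφ s hsI).1 (hu s hsI).1)
    have h2 := abs_le.1 (abs_energyFlux_le hC0 (hC.density s hsI (-R)) (hC.velocity s hsI (-R))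
      (hφ s hsI).2 (hu s hsI).2)
    simp only [sub_self, Nat.cast_ofNat, mul_one]
    norm_num
    linarith [h1.1, h2.2]
  · intro t ht
    have htI : t ∈ Icc 0 τ := ⟨hs.1.le.trans ht.1.le, ht.2.le⟩
    have hsT := Icc_subset_of_lt hτ hsI
    have htT := Icc_subset_of_lt hτ htI
    have pt := h.potential t htT
    have ps := h.potential s hsT
    have hts : |t - s| = t - s := abs_of_pos (sub_pos.2 ht.1)
    have key := integral_potential_energy_sub_le pt ps hRR
    have cρt := h.density_C1.continuous_space htT
    have cρs := h.density_C1.continuous_space hsT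
    have cφt := pt.continuous
    have cφs := ps.continuous
    have hsplit : ∀ r ∈ Ico 0 T, E r = (∫ x in (-R)..R, 1 / 2 * (ρ r x * (u r x * u r x)))
        + ∫ x in (-R)..R, (1 / 2 * deriv (φ r) x ^ 2 + U (φ r x)) := by
      intro r hr
      have c1 := h.density_C1.continuous_space hr
      have c2 := h.velocity_C1.continuous_space hr
      have c3 := (h.potential r hr).continuous_deriv
      have c4 : Continuous fun x => U (φ r x) := continuous_U.comp (h.potential r hr).continuous
      rw [← intervalIntegral.integral_add]
      · refine intervalIntegral.integral_congr fun x _ => ?_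
        simp only [energyDensity]
        ring
      all_goals exact Continuous.intervalIntegrable (by fun_prop) _ _
    have hKsplit : ∀ r ∈ Ico 0 T, K r = (∫ x in (-R)..R, 1 / 2 * (ρ r x * (u r x * u r x)))
        + ∫ x in (-R)..R, φ s x * ρ r x := by
      intro r hr
      have c1 := h.density_C1.continuous_space hr
      have c2 := h.velocity_C1.continuous_space hr
      rw [← intervalIntegral.integral_add]
      all_goals exact Continuous.intervalIntegrable (by fun_prop) _ _
    have hquad : ∫ x in (-R)..R, φ t x * (ρ t x - ρ s x)
        ≤ ((∫ x in (-R)..R, φ s x * ρ t x) - ∫ x in (-R)..R, φ s x * ρ s x)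
          + 2 * R * C ^ 2 * (t - s) ^ 2 := by
      have hconst : 2 * R * C ^ 2 * (t - s) ^ 2 = ∫ _ in (-R)..R, C ^ 2 * (t - s) ^ 2 := by
        rw [intervalIntegral.integral_const, smul_eq_mul]
        ring
      rw [hconst, ← intervalIntegral.integral_sub, ← intervalIntegral.integral_add]
      · refine intervalIntegral.integral_mono_on hRR ?_ ?_ fun x _ => ?_
        · exact Continuous.intervalIntegrable (by fun_prop) _ _
        · exact Continuous.intervalIntegrable (by fun_prop) _ _
        · have h1 := hC.potential_lip s hsI t htI x
          have h2 := hC.density_lip s hsI t htI x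
          have h3 := mul_le_mul h1 h2 (abs_nonneg _) (by positivity)
          rw [← abs_mul, hts] at h3
          have h4 := (le_abs_self _).trans h3
          linarith
      all_goals exact Continuous.intervalIntegrable (by fun_prop) _ _
    have hbd : ∀ y, |φ t y| ≤ η → |φ t y * (deriv (φ t) y - deriv (φ s) y)|
        ≤ C * η * (t - s) := by
      intro y hy
      rw [abs_mul]
      have h1 := hC.field_lip s hsI t htI y
      rw [hts] at h1
      calc _ ≤ η * (C * (t - s)) := mul_le_mul hy h1 (abs_nonneg _) ((abs_nonneg _).trans hy)
        _ = _ := by ring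
    have hb1 := (abs_le.1 (hbd R (hφ t htI).1)).2
    have hb2 := (abs_le.1 (hbd (-R) (hφ t htI).2)).1
    have e1 := hsplit t htT
    have e2 := hsplit s hsT
    change E t ≤ E s + (K t - K s) + 2 * R * C ^ 2 * (t - s) ^ 2 + 2 * C * η * (t - s)
    rw [hKsplit t htT, hKsplit s hsT]
    linarith

theorem IsClassicalSolution.energyDensity_nonneg (h : IsClassicalSolution T ρ₀ u₀ ρ u φ)
    (hρ₀ : ∀ x, 0 ≤ ρ₀ x) {t : ℝ} (ht : t ∈ Ico 0 T) (x : ℝ) :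
    0 ≤ energyDensity (ρ t) (u t) (φ t) x := by
  have h1 := h.density_nonneg hρ₀ ht x
  have h2 := U_nonneg (φ t x)
  unfold energyDensity
  positivity

theorem IsClassicalSolution.initial_eq (h : IsClassicalSolution T ρ₀ u₀ ρ u φ) {φ₀ : ℝ → ℝ}
    (hφ₀ : IsPotential ρ₀ φ₀) : ρ 0 = ρ₀ ∧ u 0 = u₀ ∧ φ 0 = φ₀ := by
  have h1 : ρ 0 = ρ₀ := funext h.density_init
  refine ⟨h1, funext h.velocity_init, ?_⟩
  have h2 := h.potential 0 ⟨le_rfl, h.pos⟩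
  rw [h1] at h2
  exact h2.unique hφ₀

/-- At every time the energy of the potential is at most the initial energy. -/
theorem IsClassicalSolution.potential_energy_le (h : IsClassicalSolution T ρ₀ u₀ ρ u φ)
    {φ₀ : ℝ → ℝ} (hρ₀ : ∀ x, 0 ≤ ρ₀ x) (hφ₀ : IsPotential ρ₀ φ₀)
    (hH₀ : Integrable (energyDensity ρ₀ u₀ φ₀)) (hτ : τ ∈ Ioo 0 T) {ε : ℝ} (hε : 0 < ε) :
    ∀ᶠ R in atTop, ∫ x in (-R)..R, (1 / 2 * deriv (φ τ) x ^ 2 + U (φ τ x))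
      ≤ energy ρ₀ u₀ φ₀ + ε := by
  obtain ⟨C, hC⟩ := h.exists_uniformBounds hτ.2
  have hC0 := hC.nonneg
  have hτ0 := hτ.1
  set κ := (C ^ 3 + 2 * C ^ 2 + 2 * C) * τ
  have hκ : 0 ≤ κ := by positivity
  -- Chosen so that κη ≤ ε; κ depends on the uniform bounds and τ but not on R, so R may be taken
  -- large afterwards.
  set η := ε / (κ + 1)
  have hη : 0 < η := by positivity
  have hsub := Icc_subset_of_lt hτ.2
  have hu := exists_uniform_decay hC.velocity_lip (fun t ht => h.velocity_infty t (hsub ht)) hη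
  have hφ := exists_uniform_decay hC.potential_lip
    (fun t ht => (h.potential t (hsub ht)).decay) hη
  have hneg : Tendsto (fun R : ℝ => -R) atTop (cocompact ℝ) :=
    tendsto_neg_atTop_atBot.mono_right atBot_le_cocompact
  filter_upwards [atTop_le_cocompact hu, atTop_le_cocompact hφ, hneg.eventually hu,
    hneg.eventually hφ, eventually_ge_atTop 0] with R u1 p1 u2 p2 hR
  have hRR : -R ≤ R := by linarith
  have h1 := h.energy_le_add hτ.1 hτ.2 hC hR (fun t ht => ⟨u1 t ht, u2 t ht⟩)
    fun t ht => ⟨p1 t ht, p2 t ht⟩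
  have hT0 : (0 : ℝ) ∈ Ico 0 T := ⟨le_rfl, h.pos⟩
  have hτT : τ ∈ Ico 0 T := Ioo_subset_Ico_self hτ
  have h2 : ∫ x in (-R)..R, energyDensity (ρ 0) (u 0) (φ 0) x ≤ energy ρ₀ u₀ φ₀ := by
    have hnn := h.energyDensity_nonneg hρ₀ hT0
    obtain ⟨e1, e2, e3⟩ := h.initial_eq hφ₀
    rw [e1, e2, e3] at hnn ⊢
    rw [intervalIntegral.integral_of_le hRR]
    exact setIntegral_le_integral hH₀ (Eventually.of_forall hnn)
  have h3 : ∫ x in (-R)..R, (1 / 2 * deriv (φ τ) x ^ 2 + U (φ τ x))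
      ≤ ∫ x in (-R)..R, energyDensity (ρ τ) (u τ) (φ τ) x := by
    have c3 := (h.potential τ hτT).continuous_deriv
    have c4 : Continuous fun x => U (φ τ x) := continuous_U.comp (h.potential τ hτT).continuous
    refine intervalIntegral.integral_mono_on hRR (Continuous.intervalIntegrable (by fun_prop) _ _)
      ((h.continuous_energyDensity hτT).intervalIntegrable _ _) fun x _ => ?_
    have := h.density_nonneg hρ₀ hτT x
    unfold energyDensity
    have : 0 ≤ 1 / 2 * ρ τ x * u τ x ^ 2 := by positivity
    linarith
  have h4 : (C ^ 3 + 2 * C ^ 2 + 2 * C) * η * τ ≤ ε := by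
    have : (C ^ 3 + 2 * C ^ 2 + 2 * C) * η * τ = κ * ε / (κ + 1) := by
      simp only [κ, η]; ring
    rw [this, div_le_iff₀ (by positivity)]
    nlinarith
  linarith

theorem energy_nonneg {ρ₀ u₀ φ₀ : ℝ → ℝ} (hρ₀ : ∀ x, 0 ≤ ρ₀ x) : 0 ≤ energy ρ₀ u₀ φ₀ := by
  refine integral_nonneg fun x => ?_
  have h1 := hρ₀ x
  have h2 := U_nonneg (φ₀ x)
  simp only [Pi.zero_apply, energyDensity]
  positivity

/-- The bounds `c₋ ≤ e^φ ≤ c₊`. -/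
theorem IsClassicalSolution.exp_potential_bounds (h : IsClassicalSolution T ρ₀ u₀ ρ u φ)
    {φ₀ : ℝ → ℝ} (hρ₀ : ∀ x, 0 ≤ ρ₀ x) (hφ₀ : IsPotential ρ₀ φ₀)
    (hH₀ : Integrable (energyDensity ρ₀ u₀ φ₀)) {t : ℝ} (ht : t ∈ Ioo 0 T) (x : ℝ) :
    cminus (energy ρ₀ u₀ φ₀) ≤ Real.exp (φ t x) ∧ Real.exp (φ t x) ≤ cplus (energy ρ₀ u₀ φ₀) := by
  have h1 := abs_le.1 ((h.potential t (Ioo_subset_Ico_self ht)).abs_Vplus_le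
    (fun ε hε => h.potential_energy_le hρ₀ hφ₀ hH₀ ht hε) x)
  have hH := energy_nonneg (u₀ := u₀) (φ₀ := φ₀) hρ₀
  exact ⟨cminus_le_exp hH h1.1, exp_le_cplus hH h1.2⟩

end

/-! ### Comparison for `y'' + k y = r` -/

/-- Sturm comparison: if `q'' + ω² q ≤ 0` on an interval of length at most `π / ω`, then `q` lies
below the solution of the harmonic oscillator with the same initial data. -/
theorem le_oscillator {q q' q'' : ℝ → ℝ} {ω a b : ℝ} (hω : 0 < ω) (hab : a ≤ b)
    (hlen : ω * (b - a) ≤ Real.pi)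
    (hqc : ContinuousOn q (Icc a b)) (hqc' : ContinuousOn q' (Icc a b))
    (hq : ∀ t ∈ Ioo a b, HasDerivAt q (q' t) t) (hq' : ∀ t ∈ Ioo a b, HasDerivAt q' (q'' t) t)
    (hle : ∀ t ∈ Ioo a b, q'' t + ω ^ 2 * q t ≤ 0) :
    q b ≤ q a * Real.cos (ω * (b - a)) + q' a * Real.sin (ω * (b - a)) / ω := by
  -- G is the value at time b of the oscillator released at time t with data (q t, q' t). Its
  -- derivative is sin(ω(b-t))/ω times q'' + ω²q, and the sine is nonnegative within half a period.
  set G : ℝ → ℝ := fun t => q t * Real.cos (ω * (b - t)) + q' t * Real.sin (ω * (b - t)) / ω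
  have hG : AntitoneOn G (Icc a b) := by
    refine antitoneOn_of_hasDerivWithinAt_nonpos (convex_Icc a b)
      (f' := fun t => Real.sin (ω * (b - t)) / ω * (q'' t + ω ^ 2 * q t)) ?_ ?_ ?_
    · fun_prop
    · intro t ht
      rw [interior_Icc] at ht ⊢
      have hl : HasDerivAt (fun s => ω * (b - s)) (-ω) t := by
        simpa using ((hasDerivAt_id t).const_sub b).const_mul ω
      have := ((hq t ht).mul hl.cos).add (((hq' t ht).mul hl.sin).div_const ω)
      refine (this.congr_deriv ?_).hasDerivWithinAt
      field_simp
      ring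
    · intro t ht
      rw [interior_Icc] at ht
      refine mul_nonpos_of_nonneg_of_nonpos (div_nonneg (Real.sin_nonneg_of_nonneg_of_le_pi ?_ ?_)
        hω.le) (hle t ht)
      · exact mul_nonneg hω.le (by linarith [ht.2])
      · refine le_trans ?_ hlen
        gcongr
        exact ht.1.le
  have := hG (left_mem_Icc.2 hab) (right_mem_Icc.2 hab) hab
  simpa [G] using this

/-- A positive solution of `y'' + k y = r`, with `0 < cm ≤ k ≤ cp`, on `[0,T)`. -/
structure IsPosSolution (T r cm cp : ℝ) (k y z : ℝ → ℝ) : Prop where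
  cont_y : ContinuousOn y (Ico 0 T)
  cont_z : ContinuousOn z (Ico 0 T)
  deriv_y : ∀ t ∈ Ioo 0 T, HasDerivAt y (z t) t
  deriv_z : ∀ t ∈ Ioo 0 T, HasDerivAt z (r - k t * y t) t
  lower : ∀ t ∈ Ioo 0 T, cm ≤ k t
  upper : ∀ t ∈ Ioo 0 T, k t ≤ cp
  pos : ∀ t ∈ Ico 0 T, 0 < y t

namespace IsPosSolution

variable {T r cm cp : ℝ} {k y z : ℝ → ℝ}

/-- Subtracting the equilibrium r/cm leaves q'' + cm q = (cm - k) y ≤ 0; this is where positivity of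
y enters. -/
theorem le_oscillator (h : IsPosSolution T r cm cp k y z) (hcm : 0 < cm) {a b : ℝ} (ha : 0 ≤ a)
    (hab : a ≤ b) (hb : b < T) (hlen : √cm * (b - a) ≤ Real.pi) :
    y b - r / cm ≤ (y a - r / cm) * Real.cos (√cm * (b - a))
      + z a * Real.sin (√cm * (b - a)) / √cm := by
  have hsub : Icc a b ⊆ Ico 0 T := fun t ht => ⟨ha.trans ht.1, ht.2.trans_lt hb⟩
  have hsub' : Ioo a b ⊆ Ioo 0 T := fun t ht => ⟨ha.trans_lt ht.1, ht.2.trans hb⟩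
  refine ColdIon.le_oscillator (q := fun t => y t - r / cm) (q' := z)
    (q'' := fun t => r - k t * y t) (Real.sqrt_pos.2 hcm) hab hlen
    ((h.cont_y.mono hsub).sub continuousOn_const) (h.cont_z.mono hsub)
    (fun t ht => (h.deriv_y t (hsub' ht)).sub_const _) (fun t ht => h.deriv_z t (hsub' ht)) ?_
  intro t ht
  have h1 := h.lower t (hsub' ht)
  have h2 := h.pos t (hsub (Ioo_subset_Icc_self ht))
  rw [Real.sq_sqrt hcm.le, mul_sub, mul_div_cancel₀ _ hcm.ne']
  nlinarith

/-- Once `y` decreases with enough energy, it vanishes within time `π / √cm`. -/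
theorem lifespan_of_nonpos (h : IsPosSolution T r cm cp k y z) (hcm : 0 < cm) (hr : 0 ≤ r) {a : ℝ}
    (ha : a ∈ Ico 0 T) (hz : z a ≤ 0) (hen : 2 * r * y a - cm * y a ^ 2 ≤ z a ^ 2) :
    T ≤ a + Real.pi / √cm := by
  by_contra! hT
  set ω := √cm
  have hω : 0 < ω := Real.sqrt_pos.2 hcm
  have hω2 : ω ^ 2 = cm := Real.sq_sqrt hcm.le
  have hy := h.pos a ha
  set q := y a - r / cm
  -- A is the amplitude of the comparison oscillator. The energy hypothesis says A ≥ r/cm, so its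
  -- trough -A brings y down to zero or below.
  set A := √(q ^ 2 + (z a / ω) ^ 2)
  have hA2 : A ^ 2 = q ^ 2 + (z a / ω) ^ 2 := Real.sq_sqrt (by positivity)
  have hrA : (r / cm) ^ 2 ≤ A ^ 2 := by
    have : A ^ 2 - (r / cm) ^ 2 = (z a ^ 2 - (2 * r * y a - cm * y a ^ 2)) / cm := by
      rw [hA2, div_pow, hω2]
      simp only [q]
      field_simp
      ring
    have h2 : 0 ≤ (z a ^ 2 - (2 * r * y a - cm * y a ^ 2)) / cm :=
      div_nonneg (by linarith) hcm.le
    linarith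
  have hA0 : 0 ≤ A := Real.sqrt_nonneg _
  have hrA' : r / cm ≤ A := abs_le_of_sq_le_sq' hrA hA0 |>.2
  have hApos : 0 < A := by
    rcases hA0.eq_or_lt with h0 | h0
    · exfalso
      have hr0 : r / cm = 0 := le_antisymm (by linarith) (by positivity)
      have hq : q = y a := by simp [q, hr0]
      rw [← h0, hq] at hA2
      nlinarith [sq_nonneg (z a / ω)]
    · exact h0
  have hqA : |q| ≤ A := abs_le_of_sq_le_sq (by nlinarith [sq_nonneg (z a / ω)]) hA0
  have hq1 : -1 ≤ q / A := by rw [le_div_iff₀ hApos]; linarith [(abs_le.1 hqA).1]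
  have hq2 : q / A ≤ 1 := by rw [div_le_iff₀ hApos]; linarith [(abs_le.1 hqA).2]
  set θ := Real.arccos (q / A)
  have hcos : q = A * Real.cos θ := by
    rw [Real.cos_arccos hq1 hq2]
    field_simp
  have hsin : z a / ω = -(A * Real.sin θ) := by
    have hs : 0 ≤ Real.sin θ := Real.sin_nonneg_of_nonneg_of_le_pi (Real.arccos_nonneg _)
      (Real.arccos_le_pi _)
    have hzω : z a / ω ≤ 0 := div_nonpos_of_nonpos_of_nonneg hz hω.le
    have hsq : (-(z a / ω)) ^ 2 = (A * Real.sin θ) ^ 2 := by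
      have h1 := Real.sin_sq_add_cos_sq θ
      rw [mul_pow, show Real.sin θ ^ 2 = 1 - Real.cos θ ^ 2 by linarith, mul_sub, ← mul_pow, ← hcos]
      linarith
    have := (sq_eq_sq₀ (neg_nonneg.2 hzω) (by positivity)).1 hsq
    linarith
  have hθ0 : 0 ≤ Real.pi - θ := by linarith [Real.arccos_le_pi (q / A)]
  have hθ1 : Real.pi - θ ≤ Real.pi := by linarith [Real.arccos_nonneg (q / A)]
  -- Since z a ≤ 0, the phase θ lies in [0, π] and the trough is reached after phase π - θ, hence
  -- within half a period.
  set b := a + (Real.pi - θ) / ω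
  have hba : ω * (b - a) = Real.pi - θ := by
    simp only [b, add_sub_cancel_left]
    field_simp
  have hbT : b < T := by
    refine lt_of_le_of_lt ?_ hT
    simp only [b]
    gcongr
  have hab : a ≤ b := le_add_of_nonneg_right (div_nonneg hθ0 hω.le)
  have := h.le_oscillator hcm ha.1 hab hbT (by rw [hba]; exact hθ1)
  rw [hba, Real.cos_pi_sub, Real.sin_pi_sub, mul_div_right_comm] at this
  change _ ≤ q * _ + z a / ω * _ at this
  rw [hsin] at this
  have hpos := h.pos b ⟨ha.1.trans hab, hbT⟩
  have h1 := Real.sin_sq_add_cos_sq θ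
  have h2 : q * -Real.cos θ + -(A * Real.sin θ) * Real.sin θ = -A := by
    rw [hcos]
    linear_combination (-A) * h1
  linarith

/-- The quantity `z² + cp y² - 2 r y` does not decrease as long as `z ≥ 0`. -/
theorem monotone_energy (h : IsPosSolution T r cm cp k y z) {b : ℝ} (hb : b < T)
    (hz : ∀ t ∈ Icc 0 b, 0 ≤ z t) :
    MonotoneOn (fun t => z t ^ 2 + cp * y t ^ 2 - 2 * r * y t) (Icc 0 b) := by
  have hsub : Icc 0 b ⊆ Ico 0 T := fun t ht => ⟨ht.1, ht.2.trans_lt hb⟩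
  have hcy := h.cont_y.mono hsub
  have hcz := h.cont_z.mono hsub
  refine monotoneOn_of_hasDerivWithinAt_nonneg (convex_Icc 0 b)
    (f' := fun t => 2 * z t * ((cp - k t) * y t)) (by fun_prop) ?_ ?_
  · intro t ht
    rw [interior_Icc] at ht ⊢
    have ht' : t ∈ Ioo 0 T := ⟨ht.1, ht.2.trans hb⟩
    have := (((h.deriv_z t ht').pow 2).add (((h.deriv_y t ht').pow 2).const_mul cp)).sub
      ((h.deriv_y t ht').const_mul (2 * r))
    refine (this.congr_deriv ?_).hasDerivWithinAt
    simp
    ring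
  · intro t ht
    rw [interior_Icc] at ht
    have ht' : t ∈ Ioo 0 T := ⟨ht.1, ht.2.trans hb⟩
    have h1 := hz t (Ioo_subset_Icc_self ht)
    have h2 := h.upper t ht'
    have h3 := h.pos t (hsub (Ioo_subset_Icc_self ht))
    exact mul_nonneg (by linarith) (mul_nonneg (by linarith) h3.le)

theorem monotone_of_nonneg (h : IsPosSolution T r cm cp k y z) {b : ℝ} (hb : b < T)
    (hz : ∀ t ∈ Icc 0 b, 0 ≤ z t) : MonotoneOn y (Icc 0 b) := by
  refine monotoneOn_of_hasDerivWithinAt_nonneg (convex_Icc 0 b) (f' := z)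
    (h.cont_y.mono fun t ht => ⟨ht.1, ht.2.trans_lt hb⟩) ?_ ?_
  · intro t ht
    rw [interior_Icc] at ht ⊢
    exact (h.deriv_y t ⟨ht.1, ht.2.trans hb⟩).hasDerivWithinAt
  · intro t ht
    exact hz t (interior_subset ht)

/-- If the energy is above its value at `y = 2 r / cm`, then `y` stops increasing within time
`√r / cm + π / √cm`. -/
theorem exists_nonpos (h : IsPosSolution T r cm cp k y z) (hcm : 0 < cm) (hcmp : cm ≤ cp)
    (hr : 0 ≤ r) (hy0 : y 0 = 1)
    (hen : 2 * r - cp + 4 / cm * (cp / cm - 1) * r ^ 2 ≤ z 0 ^ 2)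
    (hT : √r / cm + Real.pi / √cm < T) :
    ∃ t ∈ Icc 0 (√r / cm + Real.pi / √cm), z t ≤ 0 := by
  by_contra! hz
  set t₀ := √r / cm
  set ω := √cm
  have hω : 0 < ω := Real.sqrt_pos.2 hcm
  have ht₀ : 0 ≤ t₀ := by positivity
  have hpi : 0 < Real.pi / ω := div_pos Real.pi_pos hω
  have hmono := h.monotone_of_nonneg hT fun t ht => (hz t ht).le
  have hE := h.monotone_energy hT fun t ht => (hz t ht).le
  -- While y stays below r/cm the energy forces z ≥ √r; growth at that rate for time √r/cm adds r/cm
  -- to the initial value 1, a contradiction.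
  have hq : r / cm ≤ y t₀ := by
    by_contra! hlt
    have hsub : Icc 0 t₀ ⊆ Icc 0 (t₀ + Real.pi / ω) := Icc_subset_Icc_right (by linarith)
    have hz' : ∀ t ∈ Icc 0 t₀, √r ≤ z t := by
      intro t ht
      have h1 : 1 ≤ y t := by
        rw [← hy0]
        exact hmono (hsub (left_mem_Icc.2 ht₀)) (hsub ht) ht.1
      have h2 : y t ≤ r / cm :=
        (hmono (hsub ht) (hsub (right_mem_Icc.2 ht₀)) ht.2).trans hlt.le
      have h3 := hE (hsub (left_mem_Icc.2 ht₀)) (hsub ht) ht.1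
      simp only [hy0] at h3
      refine Real.sqrt_le_iff.2 ⟨(hz t (hsub ht)).le, ?_⟩
      have hd : 0 ≤ cp / cm - 1 := by rw [sub_nonneg, le_div_iff₀ hcm]; linarith
      -- The energy surplus is four times this right-hand side, so it absorbs the left-hand side,
      -- and the leftover r y is at least r because y ≥ 1.
      have h4 : cp * y t ^ 2 - r * y t ≤ (cp / cm - 1) * (r / cm) * r := by
        have h5 : y t * cm ≤ r := by rwa [le_div_iff₀ hcm] at h2
        have h6 : cp * y t ^ 2 ≤ cp / cm * (r * y t) := by
          rw [div_mul_eq_mul_div, le_div_iff₀ hcm]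
          have : 0 ≤ cp * y t * (r - y t * cm) :=
            mul_nonneg (mul_nonneg (by linarith) (by linarith)) (by linarith)
          nlinarith
        have h7 : (cp / cm - 1) * r * y t ≤ (cp / cm - 1) * r * (r / cm) := by gcongr
        linarith
      have h8 : 4 / cm * (cp / cm - 1) * r ^ 2 = 4 * ((cp / cm - 1) * (r / cm) * r) := by
        field_simp
      have h9 : 0 ≤ (cp / cm - 1) * (r / cm) * r := by positivity
      nlinarith
    have hgrow : MonotoneOn (fun t => y t - √r * t) (Icc 0 t₀) := by
      refine monotoneOn_of_hasDerivWithinAt_nonneg (convex_Icc 0 t₀) (f' := fun t => z t - √r)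
        ?_ ?_ ?_
      · exact (h.cont_y.mono fun t ht => ⟨ht.1, by linarith [ht.2]⟩).sub (by fun_prop)
      · intro t ht
        rw [interior_Icc] at ht ⊢
        have := (h.deriv_y t ⟨ht.1, by linarith [ht.2]⟩).sub ((hasDerivAt_id t).const_mul (√r))
        exact (this.congr_deriv (by simp)).hasDerivWithinAt
      · intro t ht
        exact sub_nonneg.2 (hz' t (interior_subset ht))
    have h1 := hgrow (left_mem_Icc.2 ht₀) (right_mem_Icc.2 ht₀) ht₀
    have h2 : √r * t₀ = r / cm := by
      simp only [t₀]
      rw [← mul_div_assoc, Real.mul_self_sqrt hr]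
    simp only [hy0, mul_zero] at h1
    linarith
  -- Half a period reflects the oscillator through r/cm: starting at or above equilibrium, y would
  -- end at or below it, against strict growth.
  have hosc := h.le_oscillator hcm ht₀ (by linarith) hT (b := t₀ + Real.pi / ω) (by
    rw [add_sub_cancel_left, mul_div_cancel₀ _ hω.ne'])
  rw [add_sub_cancel_left, mul_div_cancel₀ _ hω.ne', Real.cos_pi, Real.sin_pi, mul_zero,
    zero_div] at hosc
  have hstrict : y t₀ < y (t₀ + Real.pi / ω) := by
    refine (strictMonoOn_of_hasDerivWithinAt_pos (convex_Icc t₀ (t₀ + Real.pi / ω)) (f' := z)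
      (h.cont_y.mono fun t ht => ⟨ht₀.trans ht.1, ht.2.trans_lt hT⟩) ?_ ?_)
      (left_mem_Icc.2 (by linarith)) (right_mem_Icc.2 (by linarith)) (by linarith)
    · intro t ht
      rw [interior_Icc] at ht ⊢
      exact (h.deriv_y t ⟨ht₀.trans_lt ht.1, ht.2.trans hT⟩).hasDerivWithinAt
    · intro t ht
      rw [interior_Icc] at ht
      exact hz t ⟨ht₀.trans ht.1.le, ht.2.le⟩
  linarith

/-- A positive solution whose initial data violate the threshold has a bounded life span. -/
theorem lifespan_le (h : IsPosSolution T r cm cp k y z) (hcm : 0 < cm) (hcmp : cm ≤ cp)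
    (hr : 0 ≤ r) (hy0 : y 0 = 1) (hviol : ¬ Threshold cm cp r (z 0)) :
    T ≤ √r / cm + Real.pi / √cm + Real.pi / √cm := by
  have hω : 0 < √cm := Real.sqrt_pos.2 hcm
  have hpi : 0 < Real.pi / √cm := div_pos Real.pi_pos hω
  have ht₀ : 0 ≤ √r / cm := by positivity
  by_contra! hT
  have hT0 : (0 : ℝ) ∈ Ico 0 T := ⟨le_rfl, by linarith⟩
  -- Negative radicands need no separate case: the root is then 0 and squaring still bounds the
  -- radicand.
  by_cases hv : z 0 ≤ -√(2 * r - cm)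
  · have h1 : 2 * r - cm ≤ z 0 ^ 2 := by
      have := Real.sqrt_le_left (x := 2 * r - cm) (y := -z 0)
        (by linarith [Real.sqrt_nonneg (2 * r - cm)])
      have := this.1 (by linarith)
      simpa using this
    have := h.lifespan_of_nonpos hcm hr hT0 (by linarith [Real.sqrt_nonneg (2 * r - cm)])
      (by rw [hy0]; linarith)
    linarith
  · have hv' : √(2 * r - cp + 4 / cm * (cp / cm - 1) * r ^ 2) ≤ z 0 := by
      by_contra! h2
      exact hviol ⟨not_le.1 hv, h2⟩
    have hz0 : 0 ≤ z 0 := (Real.sqrt_nonneg _).trans hv'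
    have hen := (Real.sqrt_le_left hz0).1 hv'
    obtain ⟨t, ht, hzt⟩ := h.exists_nonpos hcm hcmp hr hy0 hen (by linarith)
    have hcz : ContinuousOn z (Icc 0 t) :=
      h.cont_z.mono fun s hs => ⟨hs.1, by linarith [hs.2, ht.2]⟩
    set S := Icc 0 t ∩ z ⁻¹' Iic 0
    have hS : IsCompact S := isCompact_Icc.of_isClosed_subset
      (hcz.preimage_isClosed_of_isClosed isClosed_Icc isClosed_Iic) inter_subset_left
    -- At the first turning time z vanishes and the energy is still monotone up to it.
    obtain ⟨a, ⟨haI, haz⟩, hamin⟩ := hS.exists_isLeast ⟨t, right_mem_Icc.2 ht.1, hzt⟩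
    have hpos : ∀ s ∈ Ico 0 a, 0 < z s := by
      intro s hs
      by_contra! hs'
      exact absurd (hamin ⟨⟨hs.1, hs.2.le.trans haI.2⟩, hs'⟩) (not_le.2 hs.2)
    have hza : z a = 0 := by
      refine le_antisymm haz ?_
      rcases haI.1.eq_or_lt with h0 | h0
      · rwa [← h0]
      · have hcl : a ∈ closure (Ico 0 a) := by
          rw [closure_Ico h0.ne]; exact right_mem_Icc.2 h0.le
        have := (hcz.mono (Icc_subset_Icc_right haI.2) a (right_mem_Icc.2 h0.le)).mono
          Ico_subset_Icc_self
        exact closure_minimal (s := z '' Ico 0 a) (t := Ici 0)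
          (by rintro _ ⟨s, hs, rfl⟩; exact (hpos s hs).le) isClosed_Ici
          (this.mem_closure_image hcl)
    have haT : a < T := by linarith [haI.2, ht.2]
    have hE := h.monotone_energy haT fun s hs => by
      rcases hs.2.eq_or_lt with h0 | h0
      · rw [h0, hza]
      · exact (hpos s ⟨hs.1, h0⟩).le
    have hE := hE (left_mem_Icc.2 haI.1) (right_mem_Icc.2 haI.1) haI.1
    have hya := h.pos a ⟨haI.1, haT⟩
    simp only [hy0, hza] at hE
    -- The threshold energy is cp Y² - 2rY at Y = 2r/cm. The factorization (y - Y)(cp(y + Y) - 2r),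
    -- whose second factor is positive, turns the energy inequality into y ≥ Y. There 2ry - cm y² ≤
    -- 0, so zero velocity suffices for collapse.
    have hYa : 2 * r / cm ≤ y a := by
      by_contra! hlt
      set Y := 2 * r / cm
      have hY : cm * Y = 2 * r := mul_div_cancel₀ _ hcm.ne'
      have h1 : 4 / cm * (cp / cm - 1) * r ^ 2 = cp * Y ^ 2 - 2 * r * Y := by
        simp only [Y]
        field_simp
        ring
      have h2 : 0 ≤ (y a - Y) * (cp * (y a + Y) - 2 * r) := by nlinarith
      have h3 : 0 < cp * (y a + Y) - 2 * r := by
        have hYpos : 0 < Y := hya.trans hlt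
        have : cm * Y ≤ cp * Y := by gcongr
        have : 0 < cp * y a := mul_pos (by linarith) hya
        nlinarith
      nlinarith
    have := h.lifespan_of_nonpos hcm hr ⟨haI.1, haT⟩ hza.le (by
      rw [hza]
      rw [div_le_iff₀ hcm] at hYa
      nlinarith)
    linarith [haI.2, ht.2]

end IsPosSolution

/-! ### The second-order equation along a characteristic -/

section

variable {T τ C : ℝ} {ρ₀ u₀ : ℝ → ℝ} {ρ u φ : ℝ → ℝ → ℝ} {X Y : ℝ → ℝ}

/-- Joint continuity of the field is not part of the notion of solution; it follows from the
Lipschitz bound in time. -/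
theorem continuousOn_field_along (h : IsClassicalSolution T ρ₀ u₀ ρ u φ) (hτ : τ < T)
    (hC : UniformBounds τ C ρ u φ) (hX : ContinuousOn X (Icc 0 τ)) :
    ContinuousOn (fun t => deriv (φ t) (X t)) (Icc 0 τ) :=
  (continuousOn_of_lipschitz_time hC.field_lip fun t ht =>
    (h.potential t (Icc_subset_of_lt hτ ht)).continuous_deriv).comp (f := fun t : ℝ => (t, X t))
      (continuousOn_id.prodMk hX) fun _ ht => ⟨ht, mem_univ _⟩

theorem continuousOn_potential_along (h : IsClassicalSolution T ρ₀ u₀ ρ u φ) (hτ : τ < T)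
    (hC : UniformBounds τ C ρ u φ) (hX : ContinuousOn X (Icc 0 τ)) :
    ContinuousOn (fun t => φ t (X t)) (Icc 0 τ) :=
  (continuousOn_of_lipschitz_time hC.potential_lip fun t ht =>
    (h.potential t (Icc_subset_of_lt hτ ht)).continuous).comp (f := fun t : ℝ => (t, X t))
      (continuousOn_id.prodMk hX) fun _ ht => ⟨ht, mem_univ _⟩

theorem uIcc_subset_Icc_of_mem {t : ℝ} (ht : t ∈ Icc 0 τ) : uIcc 0 t ⊆ Icc 0 τ := by
  rw [uIcc_of_le ht.1]
  exact Icc_subset_Icc_right ht.2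

theorem uIoc_subset_Icc_of_mem {t : ℝ} (ht : t ∈ Icc 0 τ) : uIoc 0 t ⊆ Icc 0 τ :=
  uIoc_subset_uIcc.trans (uIcc_subset_Icc_of_mem ht)

/-- The velocity along a characteristic changes by the integral of the force. -/
theorem IsClassicalSolution.velocity_along (h : IsClassicalSolution T ρ₀ u₀ ρ u φ) (hτ : τ < T)
    (hC : UniformBounds τ C ρ u φ) (hX : IsCharacteristic τ u X) {t : ℝ} (ht : t ∈ Icc 0 τ) :
    u t (X t) = u 0 (X 0) - ∫ s in (0 : ℝ)..t, deriv (φ s) (X s) := by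
  have hsub : Icc 0 t ⊆ Icc 0 τ := Icc_subset_Icc_right ht.2
  have h1 := intervalIntegral.integral_eq_sub_of_hasDerivAt_of_le (f := fun s => u s (X s))
    (f' := fun s => -deriv (φ s) (X s)) ht.1
    ((h.velocity_C1.continuousOn_along (Icc_subset_of_lt hτ) hX.cont).mono hsub)
    (fun s hs => by
      have hs' : s ∈ Ioo 0 τ := ⟨hs.1, hs.2.trans_le ht.2⟩
      have hsT : s ∈ Ioo 0 T := ⟨hs.1, hs'.2.trans hτ⟩
      rw [← h.momentum s hsT (X s)]
      exact h.velocity_C1.hasDerivAt_along hsT (hX.velocity s hs'))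
    (((continuousOn_field_along h hτ hC hX.cont).mono
      (uIcc_subset_Icc_of_mem ht)).neg.intervalIntegrable)
  rw [intervalIntegral.integral_neg] at h1
  linarith

/-- The gap between two characteristics in terms of the difference quotients of the velocity. -/
theorem gap_eq_exp (hu : IsClassC1 T u) (hτ : τ < T) (hX : IsCharacteristic τ u X)
    (hY : IsCharacteristic τ u Y) (hXY : ∀ t ∈ Icc 0 τ, X t < Y t) {t : ℝ} (ht : t ∈ Icc 0 τ) :
    (Y t - X t) / (Y 0 - X 0) = Real.exp (∫ s in (0 : ℝ)..t, slope (u s) (X s) (Y s)) := by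
  have hsub : Icc 0 t ⊆ Icc 0 τ := Icc_subset_Icc_right ht.2
  have hgc : ContinuousOn (fun s => Y s - X s) (Icc 0 τ) := hY.cont.sub hX.cont
  have hpos : ∀ s ∈ Icc 0 τ, 0 < Y s - X s := fun s hs => sub_pos.2 (hXY s hs)
  have hsl : ContinuousOn (fun s => slope (u s) (X s) (Y s)) (Icc 0 τ) := by
    simp only [slope_def_field]
    exact ((hu.continuousOn_along (Icc_subset_of_lt hτ) hY.cont).sub
      (hu.continuousOn_along (Icc_subset_of_lt hτ) hX.cont)).div hgc fun s hs => (hpos s hs).ne'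
  have h1 := intervalIntegral.integral_eq_sub_of_hasDerivAt_of_le
    (f := fun s => Real.log (Y s - X s)) (f' := fun s => slope (u s) (X s) (Y s)) ht.1
    ((hgc.mono hsub).log fun s hs => (hpos s (hsub hs)).ne')
    (fun s hs => by
      have hs' : s ∈ Ioo 0 τ := ⟨hs.1, hs.2.trans_le ht.2⟩
      rw [slope_def_field]
      exact ((hY.velocity s hs').sub (hX.velocity s hs')).log
        (hpos s (Ioo_subset_Icc_self hs')).ne')
    ((hsl.mono (uIcc_subset_Icc_of_mem ht)).intervalIntegrable)
  have h0 : (0 : ℝ) ∈ Icc 0 τ := ⟨le_rfl, ht.1.trans ht.2⟩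
  rw [h1, Real.exp_sub, Real.exp_log (hpos t ht), Real.exp_log (hpos 0 h0)]

theorem abs_slope_le_of_lipschitz {f : ℝ → ℝ} {M : ℝ} (hf : ∀ x y, |f x - f y| ≤ M * |x - y|)
    {a b : ℝ} (hab : a < b) : |slope f a b| ≤ M := by
  rw [slope_def_field, abs_div, div_le_iff₀ (abs_pos.2 (sub_pos.2 hab).ne')]
  exact hf b a

theorem tendsto_slope_of_hasDerivAt {ι : Type*} {l : Filter ι} {f : ℝ → ℝ} {f' a : ℝ} {b : ι → ℝ}
    (hf : HasDerivAt f f' a) (hb : Tendsto b l (𝓝 a)) (hne : ∀ᶠ i in l, b i ≠ a) :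
    Tendsto (fun i => slope f a (b i)) l (𝓝 f') :=
  (hasDerivAt_iff_tendsto_slope.1 hf).comp (tendsto_nhdsWithin_iff.2 ⟨hb, hne⟩)

/-- Integral form of the equation `(uₓ y)' = -φₓₓ y` along a characteristic, `y` the stretching
factor. -/
theorem IsClassicalSolution.deriv_mul_stretch (h : IsClassicalSolution T ρ₀ u₀ ρ u φ)
    (hτ0 : 0 ≤ τ) (hτ : τ < T) (hX : IsCharacteristic τ u X) {t : ℝ} (ht : t ∈ Icc 0 τ) :
    deriv (u t) (X t) * stretch u X t = deriv (u 0) (X 0)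
      - ∫ s in (0 : ℝ)..t, (Real.exp (φ s (X s)) - ρ s (X s)) * stretch u X s := by
  obtain ⟨C, hC⟩ := h.exists_uniformBounds hτ
  have hC0 := hC.nonneg
  have hsub := Icc_subset_of_lt hτ
  have h0 : (0 : ℝ) ∈ Icc 0 τ := ⟨le_rfl, hτ0⟩
  -- As u is only C¹, uₓ cannot be differentiated along X. Instead the integrated momentum equations
  -- on X and on a neighbouring characteristic are subtracted and divided by d, and d tends to 0
  -- from above; φₓ is differentiable by the Poisson equation.
  choose Y hY hY0 using fun d : ℝ => exists_characteristic h.velocity_C1 hτ h0 (X 0 + d)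
  set l : Filter ℝ := 𝓝[>] 0
  have hl : ∀ᶠ d in l, (0 : ℝ) < d := self_mem_nhdsWithin
  have hgap : ∀ d > 0, ∀ s ∈ Icc 0 τ, X s < Y d s ∧ Y d s - X s ≤ d * Real.exp (C * s) := by
    intro d hd s hs
    have := hX.gap h.velocity_C1 hτ hC.velocity_deriv (hY d) (by rw [hY0]; linarith) hs
    rwa [hY0, add_sub_cancel_left] at this
  have hYlim : ∀ s ∈ Icc 0 τ, Tendsto (fun d => Y d s) l (𝓝 (X s)) := by
    intro s hs
    have h2 : Tendsto (fun d : ℝ => X s + d * Real.exp (C * s)) l (𝓝 (X s)) := by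
      have : Continuous fun d : ℝ => X s + d * Real.exp (C * s) := by fun_prop
      have := this.tendsto 0
      rw [zero_mul, add_zero] at this
      exact this.mono_left nhdsWithin_le_nhds
    refine tendsto_of_tendsto_of_tendsto_of_le_of_le' tendsto_const_nhds h2 ?_ ?_
    · filter_upwards [hl] with d hd using (hgap d hd s hs).1.le
    · filter_upwards [hl] with d hd
      linarith [(hgap d hd s hs).2]
  have hYne : ∀ s ∈ Icc 0 τ, ∀ᶠ d in l, Y d s ≠ X s := fun s hs => by
    filter_upwards [hl] with d hd using (hgap d hd s hs).1.ne'
  have hD : ∀ s ∈ Icc 0 τ, Tendsto (fun d => slope (u s) (X s) (Y d s)) l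
      (𝓝 (deriv (u s) (X s))) := fun s hs =>
    tendsto_slope_of_hasDerivAt (h.velocity_C1.hasDerivAt_space (hsub hs) _) (hYlim s hs)
      (hYne s hs)
  have hE : ∀ s ∈ Icc 0 τ, Tendsto (fun d => slope (deriv (φ s)) (X s) (Y d s)) l
      (𝓝 (Real.exp (φ s (X s)) - ρ s (X s))) := fun s hs =>
    tendsto_slope_of_hasDerivAt ((h.potential s (hsub hs)).hasDerivAt_deriv _) (hYlim s hs)
      (hYne s hs)
  have hDb : ∀ d > 0, ∀ s ∈ Icc 0 τ, |slope (u s) (X s) (Y d s)| ≤ C := fun d hd s hs =>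
    abs_slope_le_of_lipschitz
      (h.velocity_C1.lipschitz_space (hsub hs) (hC.velocity_deriv s hs)) (hgap d hd s hs).1
  set B := Real.exp C + C
  have hEb : ∀ d > 0, ∀ s ∈ Icc 0 τ, |slope (deriv (φ s)) (X s) (Y d s)| ≤ B := by
    intro d hd s hs
    refine abs_slope_le_of_lipschitz (fun x y => ?_) (hgap d hd s hs).1
    refine convex_univ.norm_image_sub_le_of_norm_hasDerivWithin_le (f := deriv (φ s)) (C := B)
      (x := y) (y := x)
      (fun z _ => ((h.potential s (hsub hs)).hasDerivAt_deriv z).hasDerivWithinAt) (fun z _ => ?_)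
      (mem_univ _) (mem_univ _)
    refine (abs_sub _ _).trans (add_le_add ?_ (hC.density s hs z))
    rw [abs_of_pos (Real.exp_pos _)]
    exact Real.exp_le_exp.2 ((le_abs_self _).trans (hC.potential s hs z))
  have hslc : ∀ d > 0, ContinuousOn (fun s => slope (u s) (X s) (Y d s)) (Icc 0 τ) := by
    intro d hd
    simp only [slope_def_field]
    exact ((h.velocity_C1.continuousOn_along hsub (hY d).cont).sub
      (h.velocity_C1.continuousOn_along hsub hX.cont)).div ((hY d).cont.sub hX.cont)
      fun s hs => (sub_pos.2 (hgap d hd s hs).1).ne'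
  have hmeas : ∀ s ∈ Icc 0 τ, ∀ {f : ℝ → ℝ}, ContinuousOn f (Icc 0 τ) →
      AEStronglyMeasurable f (volume.restrict (uIoc 0 s)) := fun s hs f hf =>
    (hf.mono (uIoc_subset_Icc_of_mem hs)).aestronglyMeasurable measurableSet_uIoc
  have hYst : ∀ s ∈ Icc 0 τ, Tendsto (fun d => (Y d s - X s) / d) l (𝓝 (stretch u X s)) := by
    intro s hs
    have hint : Tendsto (fun d => ∫ r in (0 : ℝ)..s, slope (u r) (X r) (Y d r)) l
        (𝓝 (∫ r in (0 : ℝ)..s, deriv (u r) (X r))) := by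
      refine intervalIntegral.tendsto_integral_filter_of_dominated_convergence (fun _ => C) ?_ ?_
        intervalIntegrable_const ?_
      · filter_upwards [hl] with d hd using hmeas s hs (hslc d hd)
      · filter_upwards [hl] with d hd
        exact Eventually.of_forall fun r hr => hDb d hd r (uIoc_subset_Icc_of_mem hs hr)
      · exact Eventually.of_forall fun r hr => hD r (uIoc_subset_Icc_of_mem hs hr)
    refine ((Real.continuous_exp.tendsto _).comp hint).congr' ?_
    filter_upwards [hl] with d hd
    have := gap_eq_exp h.velocity_C1 hτ hX (hY d) (fun r hr => (hgap d hd r hr).1) hs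
    rw [hY0, add_sub_cancel_left] at this
    exact this.symm
  have hZ : ∀ s ∈ Icc 0 τ, Tendsto (fun d => (u s (Y d s) - u s (X s)) / d) l
      (𝓝 (deriv (u s) (X s) * stretch u X s)) := by
    intro s hs
    refine ((hD s hs).mul (hYst s hs)).congr' ?_
    filter_upwards [hl] with d hd
    have h1 := (sub_pos.2 (hgap d hd s hs).1).ne'
    rw [slope_def_field]
    field_simp
  have hF : Tendsto (fun d => ∫ s in (0 : ℝ)..t, (deriv (φ s) (Y d s) - deriv (φ s) (X s)) / d) l
      (𝓝 (∫ s in (0 : ℝ)..t, (Real.exp (φ s (X s)) - ρ s (X s)) * stretch u X s)) := by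
    refine intervalIntegral.tendsto_integral_filter_of_dominated_convergence
      (fun _ => B * Real.exp (C * τ)) ?_ ?_ intervalIntegrable_const ?_
    · filter_upwards [hl] with d hd
      exact hmeas t ht (((continuousOn_field_along h hτ hC (hY d).cont).sub
        (continuousOn_field_along h hτ hC hX.cont)).div_const d)
    · filter_upwards [hl] with d hd
      refine Eventually.of_forall fun s hs => ?_
      have hs := uIoc_subset_Icc_of_mem ht hs
      have h1 := hgap d hd s hs
      have h2 := sub_pos.2 h1.1
      have h3 : (deriv (φ s) (Y d s) - deriv (φ s) (X s)) / d
          = slope (deriv (φ s)) (X s) (Y d s) * ((Y d s - X s) / d) := by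
        rw [slope_def_field]
        field_simp
      have h4 : (Y d s - X s) / d ≤ Real.exp (C * τ) := by
        rw [div_le_iff₀ hd, mul_comm]
        refine h1.2.trans ?_
        gcongr
        exact hs.2
      have h5 : 0 ≤ (Y d s - X s) / d := by positivity
      rw [h3, Real.norm_eq_abs, abs_mul, abs_of_nonneg h5]
      exact mul_le_mul (hEb d hd s hs) h4 h5 (by positivity)
    · refine Eventually.of_forall fun s hs => ?_
      have hs := uIoc_subset_Icc_of_mem ht hs
      refine ((hE s hs).mul (hYst s hs)).congr' ?_
      filter_upwards [hl] with d hd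
      have h1 := (sub_pos.2 (hgap d hd s hs).1).ne'
      rw [slope_def_field]
      field_simp
  have hZ0 := hZ 0 h0
  rw [stretch_zero, mul_one] at hZ0
  refine tendsto_nhds_unique (hZ t ht) ((hZ0.sub hF).congr' ?_)
  filter_upwards [hl] with d hd
  rw [h.velocity_along hτ hC (hY d) ht, h.velocity_along hτ hC hX ht]
  have hi : ∀ {W : ℝ → ℝ}, IsCharacteristic τ u W →
      IntervalIntegrable (fun s => deriv (φ s) (W s)) volume 0 t := fun hW =>
    ((continuousOn_field_along h hτ hC hW.cont).mono
      (uIcc_subset_Icc_of_mem ht)).intervalIntegrable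
  rw [intervalIntegral.integral_div, intervalIntegral.integral_sub (hi (hY d)) (hi hX)]
  ring

/-- The stretching factor along a characteristic solves `y'' + e^φ y = ρ₀`. -/
theorem IsClassicalSolution.isPosSolution_stretch (h : IsClassicalSolution T ρ₀ u₀ ρ u φ)
    {φ₀ : ℝ → ℝ} (hρ₀ : ∀ x, 0 ≤ ρ₀ x) (hφ₀ : IsPotential ρ₀ φ₀)
    (hH₀ : Integrable (energyDensity ρ₀ u₀ φ₀)) (hτ0 : 0 ≤ τ) (hτ : τ < T)
    (hX : IsCharacteristic τ u X) :
    IsPosSolution τ (ρ₀ (X 0)) (cminus (energy ρ₀ u₀ φ₀)) (cplus (energy ρ₀ u₀ φ₀))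
      (fun t => Real.exp (φ t (X t))) (stretch u X)
      (fun t => deriv (u t) (X t) * stretch u X t) where
  cont_y := (continuousOn_stretch h.velocity_C1 hτ0 hτ hX).mono Ico_subset_Icc_self
  cont_z := ((h.velocity_C1.continuousOn_deriv_along (Icc_subset_of_lt hτ) hX.cont).mul
    (continuousOn_stretch h.velocity_C1 hτ0 hτ hX)).mono Ico_subset_Icc_self
  deriv_y t ht := hasDerivAt_stretch h.velocity_C1 hτ hX ht
  deriv_z t ht := by
    obtain ⟨C, hC⟩ := h.exists_uniformBounds hτ
    have hc : ContinuousOn (fun s => (Real.exp (φ s (X s)) - ρ s (X s)) * stretch u X s)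
        (Icc 0 τ) :=
      ((continuousOn_potential_along h hτ hC hX.cont).rexp.sub
        (h.density_C1.continuousOn_along (Icc_subset_of_lt hτ) hX.cont)).mul
        (continuousOn_stretch h.velocity_C1 hτ0 hτ hX)
    have h1 := (hasDerivAt_primitive hc ht).const_sub (deriv (u 0) (X 0))
    have h2 := h.density_mul_stretch hτ hX (Ioo_subset_Icc_self ht)
    refine (h1.congr_of_eventuallyEq ?_).congr_deriv (by rw [← h2]; ring)
    filter_upwards [Icc_mem_nhds ht.1 ht.2] with s hs
    exact h.deriv_mul_stretch hτ0 hτ hX hs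
  lower t ht := (h.exp_potential_bounds hρ₀ hφ₀ hH₀ ⟨ht.1, ht.2.trans hτ⟩ _).1
  upper t ht := (h.exp_potential_bounds hρ₀ hφ₀ hH₀ ⟨ht.1, ht.2.trans hτ⟩ _).2
  pos t _ := stretch_pos u X t

end

end ColdIon

end

/-! ### The life span bound for the Euler–Poisson system -/

theorem theorem1p8 (ρ₀ u₀ φ₀ : ℝ → ℝ)
    (hρ₀ : ∀ x, 0 ≤ ρ₀ x)
    (hφ₀ : ColdIon.IsPotential ρ₀ φ₀)
    (hH₀ : MeasureTheory.Integrable (ColdIon.energyDensity ρ₀ u₀ φ₀))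
    (hviol : ∃ x, ¬ ColdIon.Threshold
      (ColdIon.cminus (ColdIon.energy ρ₀ u₀ φ₀)) (ColdIon.cplus (ColdIon.energy ρ₀ u₀ φ₀))
      (ρ₀ x) (deriv u₀ x)) :
    ∃ Tstar : ℝ, 0 < Tstar ∧ ∀ (T : ℝ) (ρ u φ : ℝ → ℝ → ℝ),
      ColdIon.IsClassicalSolution T ρ₀ u₀ ρ u φ → T ≤ Tstar := by
  obtain ⟨x, hx⟩ := hviol
  set H := ColdIon.energy ρ₀ u₀ φ₀
  have hcm : 0 < ColdIon.cminus H := Real.exp_pos _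
  have hH : 0 ≤ H := ColdIon.energy_nonneg hρ₀
  have hcmp : ColdIon.cminus H ≤ ColdIon.cplus H :=
    (ColdIon.cminus_le_exp (a := 0) hH (by rw [ColdIon.Vplus_zero]; linarith)).trans
      (ColdIon.exp_le_cplus hH (by rw [ColdIon.Vplus_zero]; exact hH))
  set Ts := √(ρ₀ x) / ColdIon.cminus H + Real.pi / √(ColdIon.cminus H)
    + Real.pi / √(ColdIon.cminus H)
  have hTs : 0 < Ts := by positivity
  refine ⟨Ts, hTs, fun T ρ u φ h => ?_⟩
  by_contra! hT
  -- The uniform bounds hold only on closed intervals strictly inside [0,T), so the characteristic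
  -- is followed up to some τ with Ts < τ < T.
  obtain ⟨τ, hτ1, hτ2⟩ := exists_between hT
  have hτ0 : 0 ≤ τ := hTs.le.trans hτ1.le
  obtain ⟨X, hX, hX0⟩ := ColdIon.exists_characteristic h.velocity_C1 hτ2 ⟨le_rfl, hτ0⟩ x
  have hsol := h.isPosSolution_stretch hρ₀ hφ₀ hH₀ hτ0 hτ2 hX
  rw [hX0] at hsol
  have hz0 : deriv (u 0) (X 0) * ColdIon.stretch u X 0 = deriv u₀ x := by
    rw [ColdIon.stretch_zero, mul_one, hX0, (h.initial_eq hφ₀).2.1]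
  have := hsol.lifespan_le hcm hcmp (hρ₀ x) (ColdIon.stretch_zero u X) (by
    rw [hz0]
    exact hx)
  linarith
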